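/- Let $\tilde p:\mathbb R\to\mathbb R$ be a positive smooth $2\pi$-periodic function with $\phi:=\tilde p''+\tilde p>0$ and $\tilde p(\theta+\pi)=\tilde p(\theta)$ for all $\theta$. Let $\tilde A$ be the area enclosed by the boundary of the Wulff shape of $\tilde p$, i.e. by the curve $\theta\mapsto -\tilde p(\theta)\nu(\theta)+\tilde p'(\theta)\tau(\theta)$, where $\tau(\theta)=(\cos\theta,\sin\theta)$, $\nu(\theta)=(-\sin\theta,\cos\theta)$. For a smooth regular closed plane curve with arc length $s$, tangential angle $\theta$, unit tangent $\mathbf T$, unit normal $\mathbf N$ ($\mathbf T$ turned by $+\pi/2$) and curvature $\kappa$, put $$\mathcal K=\phi(\theta)\,\kappa,\qquad \mathcal L=\int\tilde p(\theta)\,ds,\qquad \lambda=\int\tilde p(\theta)\,\mathcal K^2\,ds,\qquad A=\tfrac12\oint x\,dy-y\,dx .$$ Let $X_0$ be a smooth, closed, embedded, strictly convex plane curve parametrized counterclockwise by its tangential angle $\theta\in\mathbb R/2\pi\mathbb Z$. Let $0<T\le\infty$ and let $X(\theta,t)$, $(\theta,t)\in \mathbb R/2\pi\mathbb Z\times[0,T)$,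 be a smooth family of regular closed curves solving $$\frac{\partial X}{\partial t}=\xi\,\mathbf T+V\,\mathbf N,\qquad V=\tilde p\Big(\mathcal K-\frac{\lambda(t)}{2\tilde A}\Big),\qquad \xi=-\frac{\partial V}{\partial\theta},\qquad X(\cdot,0)=X_0 .$$ Write $\mathcal L(t)$, $A(t)$ for the anisotropic length and the enclosed area of $X(\cdot,t)$. Then the anisoperimetric deficit $$D(t)=\frac{\mathcal L(t)^2}{4A(t)\tilde A}-1$$ is nonincreasing on $[0,T)$ and satisfies $$0\le D(t)\le D(0)\,\exp\!\Big(-\frac{8\tilde A^2}{\mathcal L(0)^2}\,t\Big)\qquad\text{for all } t\in[0,T).$$ In particular, if $T=\infty$, then $D(t)\to0$ as $t\to\infty$. -/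

import Mathlib

open Real Set Filter Topology
open scoped ContDiff

noncomputable section

namespace AnisoFlow

/-! The Euclidean plane is identified with `ℂ`; multiplication by `Complex.I` is the rotation by
a right angle. A closed curve is a `2π`-periodic map `ℝ → ℂ`. -/

/-- Speed `g = |γ'|`, so that `ds = g du`. -/
def speed (γ : ℝ → ℂ) (u : ℝ) : ℝ := ‖deriv γ u‖

/-- Unit tangent vector `T = γ' / |γ'|`. -/
def unitTangent (γ : ℝ → ℂ) (u : ℝ) : ℂ := (speed γ u)⁻¹ • deriv γ u

/-- Unit normal vector, the tangent turned by a right angle counterclockwise; it points inwards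
for a counterclockwise convex curve. -/
def unitNormal (γ : ℝ → ℂ) (u : ℝ) : ℂ := Complex.I * unitTangent γ u

/-- Signed curvature `κ = ⟨∂T/∂s, N⟩`. -/
def curvature (γ : ℝ → ℂ) (u : ℝ) : ℝ :=
  inner ℝ (deriv (unitTangent γ) u) (unitNormal γ u) / speed γ u

/-- Tangential angle: the angle from the `x`-axis to `T`. It is only used inside `2π`-periodic
functions, so the choice of the representative modulo `2π` does not matter. -/
def tangentAngle (γ : ℝ → ℂ) (u : ℝ) : ℝ := Complex.arg (unitTangent γ u)

/-- Enclosed area `A = ½ ∮ x dy - y dx`. -/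
def enclosedArea (γ : ℝ → ℂ) : ℝ :=
  (1 / 2) * ∫ u in (0 : ℝ)..(2 * π),
    ((γ u).re * (deriv γ u).im - (γ u).im * (deriv γ u).re)

/-- `p` is a positive smooth `2π`-periodic function with `p'' + p > 0`. -/
structure IsAnisotropy (p : ℝ → ℝ) : Prop where
  smooth : ContDiff ℝ ∞ p
  periodic : Function.Periodic p (2 * π)
  pos : ∀ θ, 0 < p θ
  strictConvex : ∀ θ, 0 < deriv (deriv p) θ + p θ

/-- The anisotropic function `φ = p'' + p`. -/
def anisoFunction (p : ℝ → ℝ) (θ : ℝ) : ℝ := deriv (deriv p) θ + p θ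

/-- The boundary of the Wulff shape of `p`, parametrized by its tangential angle:
`-p(θ) N(θ) + p'(θ) T(θ)` with `T(θ) = (cos θ, sin θ)` and `N(θ) = (-sin θ, cos θ)`. -/
def wulffCurve (p : ℝ → ℝ) (θ : ℝ) : ℂ :=
  -(p θ • (Complex.I * Complex.exp (θ * Complex.I))) + deriv p θ • Complex.exp (θ * Complex.I)

/-- The area enclosed by the boundary of the Wulff shape. -/
def wulffArea (p : ℝ → ℝ) : ℝ := enclosedArea (wulffCurve p)

/-- Anisotropic curvature `𝒦 = φ(θ) κ`, with `θ` the tangential angle. -/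
def anisoCurvature (p : ℝ → ℝ) (γ : ℝ → ℂ) (u : ℝ) : ℝ :=
  anisoFunction p (tangentAngle γ u) * curvature γ u

/-- Anisotropic length `∫ p(θ) ds`. -/
def anisoLength (p : ℝ → ℝ) (γ : ℝ → ℂ) : ℝ :=
  ∫ u in (0 : ℝ)..(2 * π), p (tangentAngle γ u) * speed γ u

/-- The nonlocal term `λ = ∫ p(θ) 𝒦² ds`. -/
def nonlocalTerm (p : ℝ → ℝ) (γ : ℝ → ℂ) : ℝ :=
  ∫ u in (0 : ℝ)..(2 * π), p (tangentAngle γ u) * anisoCurvature p γ u ^ 2 * speed γ u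

/-- Normal speed `p(θ) (𝒦 - λ / (2 Ã))`, where `Ã` is the area of the Wulff shape. -/
def normalSpeed (p : ℝ → ℝ) (γ : ℝ → ℂ) (u : ℝ) : ℝ :=
  p (tangentAngle γ u) * (anisoCurvature p γ u - nonlocalTerm p γ / (2 * wulffArea p))

/-- The anisoperimetric deficit `𝓛² / (4 A Ã) - 1`. -/
def anisoDeficit (p : ℝ → ℝ) (γ : ℝ → ℂ) : ℝ :=
  anisoLength p γ ^ 2 / (4 * enclosedArea γ * wulffArea p) - 1

/-- `γ` is a smooth regular closed curve parametrized by its tangential angle `θ ∈ [0, 2π)`: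
at parameter `θ` the unit tangent is `(cos θ, sin θ)`. Such a curve has curvature
`1 / |γ'| > 0` and rotation number one. Up to parametrization these are exactly the smooth, closed,
embedded, strictly convex curves, run through counterclockwise. -/
structure IsConvexByAngle (γ : ℝ → ℂ) : Prop where
  smooth : ContDiff ℝ ∞ γ
  periodic : Function.Periodic γ (2 * π)
  regular : ∀ θ, deriv γ θ ≠ 0
  tangent : ∀ θ : ℝ, unitTangent γ θ = Complex.exp (θ * Complex.I)

/-- The time interval `[0, T)`, where `T = ∞` is allowed. -/
def timeInterval (T : EReal) : Set ℝ := {t | 0 ≤ t ∧ (t : EReal) < T}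

/-- `X t θ` is a smooth solution for `t ∈ [0, T)` of `∂X/∂t = ξ 𝐓 + V 𝐍`, `X(0) = X₀`, where `𝐓`, `𝐍`
are the unit tangent and the unit inward normal of `X t`, with normal speed `V = p (𝒦 - λ / (2 Ã))` and tangential speed
`ξ = -∂V/∂θ`. Nothing but regularity is required of the curves at positive times: that `θ` is
the tangential angle of `X t` (hence that `X t` is convex) is asked of `X₀` only. -/
structure IsFlow (p : ℝ → ℝ) (X₀ : ℝ → ℂ) (T : EReal) (X : ℝ → ℝ → ℂ) : Prop where
  smooth : ContDiffOn ℝ ∞ (fun q : ℝ × ℝ => X q.1 q.2) (timeInterval T ×ˢ univ)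
  periodic : ∀ t ∈ timeInterval T, Function.Periodic (X t) (2 * π)
  regular : ∀ t ∈ timeInterval T, ∀ θ, deriv (X t) θ ≠ 0
  initial : X 0 = X₀
  evolution : ∀ t ∈ timeInterval T, ∀ θ,
    HasDerivWithinAt (fun τ => X τ θ)
      (-(deriv (normalSpeed p (X t)) θ) • unitTangent (X t) θ
        + normalSpeed p (X t) θ • unitNormal (X t) θ)
      (timeInterval T) t

end AnisoFlow

end

/-! Write `L`, `A`, `W` for anisotropic length, enclosed area and Wulff area, and `λ` for the
nonlocal term. The tangential speed `-∂V/∂θ` is the one that keeps `θ` the tangential angle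
(`tangent_preserved`), so the curves stay convex and are described by the support function `h`,
which obeys `h_t = -V` and `h + h'' = g`, the speed. In these terms `λ/(2W)` is the constant that
makes `L` stationary, while `A' = λL/(2W) - 2W`.

Gage's inequality `W L ≤ λ A` then gives `A' ≥ (L² - 4AW)/(2A)`, hence `D' ≤ -(L²/(2A²)) D`. The
isoperimetric inequality `4AW ≤ L²` gives `D ≥ 0` and bounds the rate `L²/(2A²)` below by `8W²/L²`.
Integration gives the exponential bound.

Both inequalities come from `gage_inequalities`, where the symmetry of `p` enters. By continuity
some chord joining points with opposite tangents bisects the area. With the origin at its midpoint,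
`h` and `p` each have matching values and slopes at the ends of each half-period. There Wirtinger's
inequality, applied to `h - r p` with `r = h(v)/p(v)`, shows that the Bonnesen quadratic is
nonpositive at `r` (`bonnesen`). One such `r` gives the isoperimetric inequality on each half.
Integrating over `v` with weight `p g` bounds `∫ h² g / p`, and Cauchy–Schwarz for `L = ∫ h φ` turns
this bound into Gage's inequality. -/

namespace AnisoFlow

/-! ### Wirtinger's inequality on an interval of length `π`. -/

/-- The square of a function vanishing at `v`, times `cot (u - v)`, is continuous near `v`. -/
theorem continuousOn_sq_mul_cot {f : ℝ → ℝ} {v a b : ℝ} (hf : Differentiable ℝ f) (hv : f v = 0)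
    (ha : ∀ u ∈ Icc a b, u ≠ v → sin (u - v) ≠ 0) :
    ContinuousOn (fun u => f u ^ 2 * (cos (u - v) / sin (u - v))) (Icc a b) := by
  intro u hu
  by_cases huv : u = v
  · subst huv
    have hq : Continuous (dslope f u) := by
      rw [continuous_iff_continuousAt]
      intro x
      by_cases hx : x = u
      · subst hx; exact continuousAt_dslope_same.2 (hf x)
      · exact (continuousAt_dslope_of_ne hx).2 (hf x).continuousAt
    have hs : Continuous (dslope (fun x => sin (x - u)) u) := by
      rw [continuous_iff_continuousAt]
      intro x
      have hd : Differentiable ℝ (fun x => sin (x - u)) := by fun_prop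
      by_cases hx : x = u
      · subst hx; exact continuousAt_dslope_same.2 (hd x)
      · exact (continuousAt_dslope_of_ne hx).2 (hd x).continuousAt
    have hs0 : dslope (fun x => sin (x - u)) u u ≠ 0 := by
      rw [dslope_same]
      have : HasDerivAt (fun x => sin (x - u)) (cos (u - u) * 1) u :=
        ((hasDerivAt_id u).sub_const u).sin
      rw [this.deriv]; simp
    -- Both `f` and `sin (· - u)` have a simple factor `x - u`, so the product still vanishes at
    -- `u`, in agreement with the convention `1 / 0 = 0`.
    have key : ∀ x, f x ^ 2 * (cos (x - u) / sin (x - u)) =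
        (x - u) * dslope f u x ^ 2 * (cos (x - u) / dslope (fun x => sin (x - u)) u x) := by
      intro x
      have e1 := sub_smul_dslope f u x
      have e2 := sub_smul_dslope (fun x => sin (x - u)) u x
      simp only [hv, sub_zero, smul_eq_mul, sub_self, sin_zero] at e1 e2
      rw [← e1]
      conv_lhs => rw [← e2]
      by_cases hx : x - u = 0
      · simp [hx]
      · by_cases h0 : dslope (fun x => sin (x - u)) u x = 0
        · simp [h0]
        · field_simp
    simp_rw [key]
    apply ContinuousAt.continuousWithinAt
    apply ContinuousAt.mul (by fun_prop)
    exact ContinuousAt.div (by fun_prop) hs.continuousAt hs0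
  · apply ContinuousAt.continuousWithinAt
    apply ContinuousAt.mul (hf.continuous.pow 2).continuousAt
    exact ContinuousAt.div (by fun_prop) (by fun_prop) (ha u hu huv)

/-- Wirtinger's inequality on an interval of length `π`, for a function with an interior zero and
matching boundary values. -/
theorem integral_sq_le_integral_deriv_sq {f f' : ℝ → ℝ} {a v : ℝ}
    (hf : ∀ u, HasDerivAt f (f' u) u) (hf' : Continuous f') (hv : f v = 0)
    (hav : v ∈ Ioo a (a + π)) (hper : f (a + π) = f a) :
    ∫ u in a..(a + π), (f u ^ 2 - f' u ^ 2) ≤ 0 := by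
  have hd : Differentiable ℝ f := fun u => (hf u).differentiableAt
  have hsin : ∀ u ∈ Icc a (a + π), u ≠ v → sin (u - v) ≠ 0 := by
    intro u hu huv h0
    rcases lt_or_gt_of_ne huv with h | h
    · have := sin_pos_of_pos_of_lt_pi (x := v - u) (by linarith) (by linarith [hu.1, hav.2])
      rw [← neg_sub, sin_neg] at h0; linarith
    · have := sin_pos_of_pos_of_lt_pi (x := u - v) (by linarith) (by linarith [hu.2, hav.1])
      linarith
  have hc : Continuous fun u => f' u ^ 2 - f u ^ 2 := by
    have := hd.continuous
    fun_prop
  -- The subtracted term completes the square: away from `v`, `H' = (f' - f cot (u - v))²`.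
  set H : ℝ → ℝ := fun u => (∫ x in a..u, (f' x ^ 2 - f x ^ 2)) -
    f u ^ 2 * (cos (u - v) / sin (u - v)) with hH
  have hHd : ∀ u ∈ Icc a (a + π), u ≠ v → DifferentiableAt ℝ H u ∧ 0 ≤ deriv H u := by
    intro u hu huv
    have hs := hsin u hu huv
    have h1 : HasDerivAt (fun u => ∫ x in a..u, (f' x ^ 2 - f x ^ 2)) (f' u ^ 2 - f u ^ 2) u :=
      intervalIntegral.integral_hasDerivAt_right (hc.intervalIntegrable _ _)
        hc.aestronglyMeasurable.stronglyMeasurableAtFilter hc.continuousAt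
    have hsub : HasDerivAt (fun x : ℝ => x - v) 1 u := (hasDerivAt_id u).sub_const v
    have h2 := h1.sub (((hf u).pow 2).mul (hsub.cos.div hsub.sin hs))
    have h3 : HasDerivAt H _ u := h2
    refine ⟨h3.differentiableAt, ?_⟩
    rw [h3.deriv]
    have : 0 ≤ (f' u - f u * (cos (u - v) / sin (u - v))) ^ 2 := sq_nonneg _
    refine this.trans (le_of_eq ?_)
    simp only [Pi.pow_apply, Pi.div_apply, Nat.cast_ofNat, Nat.add_one_sub_one, pow_one]
    field_simp
    ring
  have hHc : ContinuousOn H (Icc a (a + π)) := by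
    refine ContinuousOn.sub ?_ (continuousOn_sq_mul_cot hd hv hsin)
    exact (intervalIntegral.continuous_primitive (fun _ _ => hc.intervalIntegrable _ _) a
      ).continuousOn
  have mono : ∀ b c, b ≤ c → a ≤ b → c ≤ a + π → v ∉ Ioo b c → H b ≤ H c := by
    intro b c hbc hb hc' hvbc
    have hd' : ∀ u ∈ interior (Icc b c), DifferentiableAt ℝ H u ∧ 0 ≤ deriv H u := by
      intro u hu
      rw [interior_Icc] at hu
      exact hHd u ⟨hb.trans hu.1.le, hu.2.le.trans hc'⟩ (by rintro rfl; exact hvbc hu)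
    exact monotoneOn_of_deriv_nonneg (convex_Icc b c) (hHc.mono (Icc_subset_Icc hb hc'))
      (fun u hu => (hd' u hu).1.differentiableWithinAt) (fun u hu => (hd' u hu).2)
      (left_mem_Icc.2 hbc) (right_mem_Icc.2 hbc) hbc
  have m1 : H a ≤ H v := mono a v hav.1.le le_rfl hav.2.le (by simp)
  have m2 : H v ≤ H (a + π) := mono v (a + π) hav.2.le hav.1.le le_rfl (by simp)
  -- Since `cot` has period `π` and `f` matches at the ends, the boundary terms of `H` cancel.
  have e : cos (a + π - v) / sin (a + π - v) = cos (a - v) / sin (a - v) := by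
    rw [show a + π - v = (a - v) + π by ring, cos_add_pi, sin_add_pi, neg_div_neg_eq]
  have := m1.trans m2
  simp only [hH, intervalIntegral.integral_same, e, hper] at this
  have e2 : ∫ u in a..(a + π), (f u ^ 2 - f' u ^ 2) = - ∫ u in a..(a + π), (f' u ^ 2 - f u ^ 2) := by
    rw [← intervalIntegral.integral_neg]; simp
  linarith
-- Mixed areas and the relative Bonnesen inequality on a half-period.
/-- The mixed area of two support functions with matching boundary data is symmetric. -/
theorem integral_mul_eq_integral_mul {p p' φ h h' g : ℝ → ℝ} {a b : ℝ}
    (hp : ∀ u, HasDerivAt p (p' u) u) (hp' : ∀ u, HasDerivAt p' (φ u - p u) u)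
    (hh : ∀ u, HasDerivAt h (h' u) u) (hh' : ∀ u, HasDerivAt h' (g u - h u) u)
    (cφ : Continuous φ) (cg : Continuous g) (bp : p b = p a) (bp' : p' b = p' a)
    (bh : h b = h a) (bh' : h' b = h' a) :
    ∫ u in a..b, h u * φ u = ∫ u in a..b, p u * g u := by
  have cp : Continuous p := continuous_iff_continuousAt.2 fun u => (hp u).continuousAt
  have ch : Continuous h := continuous_iff_continuousAt.2 fun u => (hh u).continuousAt
  have I0 : ∫ u in a..b, (p u * g u - h u * φ u) = 0 := by
    rw [intervalIntegral.integral_eq_sub_of_hasDerivAt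
      (f := fun u => p u * h' u - p' u * h u)]
    · simp only [bh, bh', bp, bp', sub_self]
    · intro u _
      exact (((hp u).mul (hh' u)).sub ((hp' u).mul (hh u))).congr_deriv (by ring)
    · exact Continuous.intervalIntegrable (by fun_prop) _ _
  rw [intervalIntegral.integral_sub (Continuous.intervalIntegrable (by fun_prop) _ _)
    (Continuous.intervalIntegrable (by fun_prop) _ _)] at I0
  linarith

/-- A relative Bonnesen inequality for support functions `h`, `p` on an interval of length `π`
with matching boundary data. -/
theorem bonnesen {p p' φ h h' g : ℝ → ℝ} {a v : ℝ}
    (hp : ∀ u, HasDerivAt p (p' u) u) (hp' : ∀ u, HasDerivAt p' (φ u - p u) u)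
    (hh : ∀ u, HasDerivAt h (h' u) u) (hh' : ∀ u, HasDerivAt h' (g u - h u) u)
    (cφ : Continuous φ) (cg : Continuous g) (pos : ∀ u, 0 < p u)
    (bp : p (a + π) = p a) (bp' : p' (a + π) = p' a)
    (bh : h (a + π) = h a) (bh' : h' (a + π) = h' a) (hv : v ∈ Ioo a (a + π)) :
    (∫ u in a..(a + π), h u * g u) / 2 - (h v / p v) * (∫ u in a..(a + π), p u * g u) +
      (h v / p v) ^ 2 * ((∫ u in a..(a + π), p u * φ u) / 2) ≤ 0 := by
  set r := h v / p v with hr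
  have cp : Continuous p := continuous_iff_continuousAt.2 fun u => (hp u).continuousAt
  have cp' : Continuous p' := continuous_iff_continuousAt.2 fun u => (hp' u).continuousAt
  have ch : Continuous h := continuous_iff_continuousAt.2 fun u => (hh u).continuousAt
  have ch' : Continuous h' := continuous_iff_continuousAt.2 fun u => (hh' u).continuousAt
  -- The ratio `r` is chosen so that `h - r p` vanishes at `v`.
  have W := integral_sq_le_integral_deriv_sq (f := fun u => h u - r * p u)
    (f' := fun u => h' u - r * p' u) (a := a) (v := v)
    (fun u => (hh u).sub ((hp u).const_mul r)) (by fun_prop)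
    (by rw [hr]; field_simp [(pos v).ne']; ring) hv (by rw [bh, bp])
  -- Integration by parts: `f (f + f'')` and `f² - f'²` differ by `(f f')'`, for `f = h - r p`.
  have I1 : ∫ u in a..(a + π), ((h u - r * p u) * (g u - r * φ u) -
      ((h u - r * p u) ^ 2 - (h' u - r * p' u) ^ 2)) = 0 := by
    rw [intervalIntegral.integral_eq_sub_of_hasDerivAt
      (f := fun u => (h u - r * p u) * (h' u - r * p' u))]
    · simp only [bh, bh', bp, bp', sub_self]
    · intro u _
      exact (((hh u).sub ((hp u).const_mul r)).mul
        ((hh' u).sub ((hp' u).const_mul r))).congr_deriv (by simp only [Pi.sub_apply]; ring)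
    · exact Continuous.intervalIntegrable (by fun_prop) _ _
  have i1 : IntervalIntegrable (fun u => h u * g u) MeasureTheory.volume a (a + π) :=
    Continuous.intervalIntegrable (by fun_prop) _ _
  have i2 : IntervalIntegrable (fun u => p u * g u) MeasureTheory.volume a (a + π) :=
    Continuous.intervalIntegrable (by fun_prop) _ _
  have i3 : IntervalIntegrable (fun u => h u * φ u) MeasureTheory.volume a (a + π) :=
    Continuous.intervalIntegrable (by fun_prop) _ _
  have i4 : IntervalIntegrable (fun u => p u * φ u) MeasureTheory.volume a (a + π) :=
    Continuous.intervalIntegrable (by fun_prop) _ _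
  rw [intervalIntegral.integral_sub (Continuous.intervalIntegrable (by fun_prop) _ _)
    (Continuous.intervalIntegrable (by fun_prop) _ _)] at I1
  have I2 : ∫ u in a..(a + π), (h u - r * p u) * (g u - r * φ u) =
      (∫ u in a..(a + π), h u * g u) - r * (∫ u in a..(a + π), p u * g u) -
      r * (∫ u in a..(a + π), h u * φ u) + r ^ 2 * (∫ u in a..(a + π), p u * φ u) := by
    rw [← intervalIntegral.integral_const_mul, ← intervalIntegral.integral_const_mul,
      ← intervalIntegral.integral_const_mul, ← intervalIntegral.integral_sub i1 (i2.const_mul r),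
      ← intervalIntegral.integral_sub (i1.sub (i2.const_mul r)) (i3.const_mul r),
      ← intervalIntegral.integral_add ((i1.sub (i2.const_mul r)).sub (i3.const_mul r))
        (i4.const_mul _)]
    congr 1; ext u; ring
  have I3 : ∫ u in a..(a + π), h u * φ u = ∫ u in a..(a + π), p u * g u :=
    integral_mul_eq_integral_mul hp hp' hh hh' cφ cg bp bp' bh bh'
  rw [I3] at I2
  linarith

/-- On an interval of length `π` with matching boundary data, the isoperimetric inequality and
the bound on `∫ h² g / p`. -/
theorem half_inequalities {p p' φ h h' g : ℝ → ℝ} {a : ℝ}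
    (hp : ∀ u, HasDerivAt p (p' u) u) (hp' : ∀ u, HasDerivAt p' (φ u - p u) u)
    (hh : ∀ u, HasDerivAt h (h' u) u) (hh' : ∀ u, HasDerivAt h' (g u - h u) u)
    (cφ : Continuous φ) (cg : Continuous g) (pos : ∀ u, 0 < p u) (gpos : ∀ u, 0 < g u)
    (φpos : ∀ u, 0 < φ u)
    (bp : p (a + π) = p a) (bp' : p' (a + π) = p' a)
    (bh : h (a + π) = h a) (bh' : h' (a + π) = h' a) :
    (∫ u in a..(a + π), h u * g u) * (∫ u in a..(a + π), p u * φ u) ≤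
      (∫ u in a..(a + π), p u * g u) ^ 2 ∧
    (∫ u in a..(a + π), p u * φ u) * (∫ u in a..(a + π), h u ^ 2 * g u / p u) ≤
      (∫ u in a..(a + π), h u * g u) * (∫ u in a..(a + π), p u * g u) := by
  have B := fun v (hv : v ∈ Ioo a (a + π)) =>
    bonnesen hp hp' hh hh' cφ cg pos bp bp' bh bh' hv
  have cp : Continuous p := continuous_iff_continuousAt.2 fun u => (hp u).continuousAt
  have ch : Continuous h := continuous_iff_continuousAt.2 fun u => (hh u).continuousAt
  set S := ∫ u in a..(a + π), h u * g u
  set l := ∫ u in a..(a + π), p u * g u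
  set w := ∫ u in a..(a + π), p u * φ u
  constructor
  -- Any interior point would do: a quadratic in `r` with leading coefficient `w / 2 ≥ 0` that takes
  -- a nonpositive value has discriminant `l² - S w ≥ 0`.
  · have := B (a + π / 2) ⟨by linarith [pi_pos], by linarith [pi_pos]⟩
    set r := h (a + π / 2) / p (a + π / 2)
    have hw0 : 0 ≤ w := intervalIntegral.integral_nonneg (by linarith [pi_pos])
      fun u _ => (mul_pos (pos u) (φpos u)).le
    nlinarith [sq_nonneg (l - w * r), mul_nonneg hw0 (neg_nonneg.2 this)]
  -- The Bonnesen inequality at `v`, multiplied by `p v * g v` to clear the denominator usefully, is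
  -- integrated over `v`.
  · have hle : ∫ u in a..(a + π), ((p u * g u) * (S / 2) - (h u * g u) * l +
        (h u ^ 2 * g u / p u) * (w / 2)) ≤ ∫ u in a..(a + π), (0 : ℝ) := by
      refine intervalIntegral.integral_mono_on_of_le_Ioo (by linarith [pi_pos]) ?_ (by simp) ?_
      · exact Continuous.intervalIntegrable (by fun_prop (disch := exact fun u => (pos u).ne')) _ _
      · intro v hv
        have := mul_nonpos_of_nonneg_of_nonpos (mul_pos (pos v) (gpos v)).le (B v hv)
        refine le_trans (le_of_eq ?_) this
        field_simp [(pos v).ne']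
    have i1 : IntervalIntegrable (fun u => h u * g u) MeasureTheory.volume a (a + π) :=
      Continuous.intervalIntegrable (by fun_prop) _ _
    have i2 : IntervalIntegrable (fun u => p u * g u) MeasureTheory.volume a (a + π) :=
      Continuous.intervalIntegrable (by fun_prop) _ _
    have i3 : IntervalIntegrable (fun u => h u ^ 2 * g u / p u) MeasureTheory.volume a (a + π) :=
      Continuous.intervalIntegrable (by fun_prop (disch := exact fun u => (pos u).ne')) _ _
    rw [intervalIntegral.integral_add ((i2.mul_const _).sub (i1.mul_const _)) (i3.mul_const _),
      intervalIntegral.integral_sub (i2.mul_const _) (i1.mul_const _),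
      intervalIntegral.integral_mul_const, intervalIntegral.integral_mul_const,
      intervalIntegral.integral_mul_const, intervalIntegral.integral_zero] at hle
    linarith
-- Positivity of the area and the bisecting chord.
/-- Twice the enclosed area, computed with an arbitrary origin. -/
theorem integral_support_mul {x y g : ℝ → ℝ}
    (hx : ∀ u, HasDerivAt x (g u * cos u) u) (hy : ∀ u, HasDerivAt y (g u * sin u) u)
    (cg : Continuous g) (a b c d : ℝ) :
    ∫ u in c..d, ((x u - a) * sin u - (y u - b) * cos u) * g u =
      (∫ u in c..d, (x u * (g u * sin u) - y u * (g u * cos u))) - a * (y d - y c)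
        + b * (x d - x c) := by
  have cx : Continuous x := continuous_iff_continuousAt.2 fun u => (hx u).continuousAt
  have cy : Continuous y := continuous_iff_continuousAt.2 fun u => (hy u).continuousAt
  have ix : IntervalIntegrable (fun u => g u * cos u) MeasureTheory.volume c d :=
    Continuous.intervalIntegrable (by fun_prop) _ _
  have iy : IntervalIntegrable (fun u => g u * sin u) MeasureTheory.volume c d :=
    Continuous.intervalIntegrable (by fun_prop) _ _
  rw [← intervalIntegral.integral_eq_sub_of_hasDerivAt (fun u _ => hx u) ix,
    ← intervalIntegral.integral_eq_sub_of_hasDerivAt (fun u _ => hy u) iy,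
    ← intervalIntegral.integral_const_mul, ← intervalIntegral.integral_const_mul,
    ← intervalIntegral.integral_sub (Continuous.intervalIntegrable (by fun_prop) _ _)
      (iy.const_mul a),
    ← intervalIntegral.integral_add (Continuous.intervalIntegrable (by fun_prop) _ _)
      (ix.const_mul b)]
  congr 1; ext u; ring

/-- A closed curve parametrized by its tangential angle encloses positive area. -/
theorem area_pos {x y g : ℝ → ℝ}
    (hx : ∀ u, HasDerivAt x (g u * cos u) u) (hy : ∀ u, HasDerivAt y (g u * sin u) u)
    (cg : Continuous g) (gpos : ∀ u, 0 < g u)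
    (xper : Function.Periodic x (2 * π)) (yper : Function.Periodic y (2 * π)) :
    0 < ∫ u in (0 : ℝ)..(2 * π), (x u * (g u * sin u) - y u * (g u * cos u)) := by
  have cx : Continuous x := continuous_iff_continuousAt.2 fun u => (hx u).continuousAt
  have cy : Continuous y := continuous_iff_continuousAt.2 fun u => (hy u).continuousAt
  have x2 : x (2 * π) = x 0 := by simpa using xper 0
  have y2 : y (2 * π) = y 0 := by simpa using yper 0
  have key := integral_support_mul hx hy cg (x 0) (y 0) 0 (2 * π)
  rw [x2, y2, sub_self, sub_self, mul_zero, mul_zero, sub_zero, add_zero] at key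
  rw [← key]
  -- With the origin on the curve at parameter `0`, the support function at `u` is the total
  -- displacement normal to the tangent at `u`. Its rate `g s * sin (u - s)` has one sign on `[0,
  -- u]` if `u ≤ π`, and on `[u, 2π]` otherwise.
  have hm : ∀ u s, HasDerivAt (fun s => (x s - x 0) * sin u - (y s - y 0) * cos u)
      (g s * sin (u - s)) s := by
    intro u s
    refine ((((hx s).sub_const _).mul_const _).sub (((hy s).sub_const _).mul_const _)).congr_deriv ?_
    rw [sin_sub]; ring
  refine intervalIntegral.intervalIntegral_pos_of_pos_on
    (Continuous.intervalIntegrable (by fun_prop) _ _) ?_ (by positivity)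
  intro u hu
  refine mul_pos ?_ (gpos u)
  rcases le_or_gt u π with hle | hlt
  · have mono : StrictMonoOn (fun s => (x s - x 0) * sin u - (y s - y 0) * cos u) (Icc 0 u) := by
      refine strictMonoOn_of_deriv_pos (convex_Icc _ _) (by fun_prop) ?_
      intro s hs
      rw [interior_Icc] at hs
      rw [(hm u s).deriv]
      exact mul_pos (gpos s) (sin_pos_of_pos_of_lt_pi (by linarith [hs.2]) (by linarith [hs.1]))
    have := mono (left_mem_Icc.2 hu.1.le) (right_mem_Icc.2 hu.1.le) hu.1
    simpa using this
  · have anti : StrictAntiOn (fun s => (x s - x 0) * sin u - (y s - y 0) * cos u)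
        (Icc u (2 * π)) := by
      refine strictAntiOn_of_deriv_neg (convex_Icc _ _) (by fun_prop) ?_
      intro s hs
      rw [interior_Icc] at hs
      rw [(hm u s).deriv]
      exact mul_neg_of_pos_of_neg (gpos s)
        (sin_neg_of_neg_of_neg_pi_lt (by linarith [hs.1]) (by linarith [hs.2]))
    have := anti (left_mem_Icc.2 hu.2.le) (right_mem_Icc.2 hu.2.le) hu.2
    simpa [x2, y2] using this

/-- There are a point `a` and a chord joining the points with opposite tangents at `a` and `a + π`
that bisects the enclosed area. -/
theorem exists_bisecting_chord {x y g : ℝ → ℝ}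
    (hx : ∀ u, HasDerivAt x (g u * cos u) u) (hy : ∀ u, HasDerivAt y (g u * sin u) u)
    (cg : Continuous g)
    (xper : Function.Periodic x (2 * π)) (yper : Function.Periodic y (2 * π)) :
    ∃ a, (∫ u in a..(a + π), (x u * (g u * sin u) - y u * (g u * cos u))) +
      x (a + π) * y a - y (a + π) * x a =
      (∫ u in (0 : ℝ)..(2 * π), (x u * (g u * sin u) - y u * (g u * cos u))) / 2 := by
  have cx : Continuous x := continuous_iff_continuousAt.2 fun u => (hx u).continuousAt
  have cy : Continuous y := continuous_iff_continuousAt.2 fun u => (hy u).continuousAt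
  set F : ℝ → ℝ := fun u => x u * (g u * sin u) - y u * (g u * cos u) with hF
  have cF : Continuous F := by fun_prop
  have iF : ∀ a b, IntervalIntegrable F MeasureTheory.volume a b :=
    fun a b => cF.intervalIntegrable a b
  -- Twice the area between the arc from `a` to `a + π` and its chord. The pieces for `0` and `π`
  -- add up to the whole, so one is at most half and one at least half.
  set G : ℝ → ℝ := fun a => (∫ u in a..(a + π), F u) + x (a + π) * y a - y (a + π) * x a
  have cG : Continuous G := by
    have cI := intervalIntegral.continuous_primitive iF 0
    have : (fun a => ∫ u in a..(a + π), F u) =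
        fun a => (∫ u in (0:ℝ)..(a + π), F u) - ∫ u in (0:ℝ)..a, F u := by
      ext a; rw [intervalIntegral.integral_interval_sub_left (iF _ _) (iF _ _)]
    have c1 : Continuous (fun a => ∫ u in a..(a + π), F u) := by
      rw [this]; exact (cI.comp (continuous_add_const π)).sub cI
    fun_prop
  have hsum : G 0 + G π = ∫ u in (0 : ℝ)..(2 * π), F u := by
    have h1 : ∫ u in (0 : ℝ)..(2 * π), F u = (∫ u in (0:ℝ)..π, F u) + ∫ u in π..(2 * π), F u :=
      (intervalIntegral.integral_add_adjacent_intervals (iF _ _) (iF _ _)).symm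
    have x2 : x (2 * π) = x 0 := by simpa using xper 0
    have y2 : y (2 * π) = y 0 := by simpa using yper 0
    simp only [G, zero_add, ← two_mul, x2, y2]
    rw [h1]; ring
  change ∃ a, G a = (∫ u in (0 : ℝ)..(2 * π), F u) / 2
  have := mem_range_of_exists_le_of_exists_ge cG
    (c := (∫ u in (0 : ℝ)..(2 * π), F u) / 2)
    (by by_contra! h; linarith [h 0, h π]) (by by_contra! h; linarith [h 0, h π])
  exact this

/-! ### The isoperimetric and Gage inequalities for the closed curve. -/

/-- The isoperimetric inequality and Gage's inequality relative to a centrally symmetric Wulff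
shape, for a closed curve `(x, y)` parametrized by its tangential angle. Here `S` is twice the
enclosed area and `w` is twice the area of the Wulff shape. -/
theorem gage_inequalities {p p' φ x y g : ℝ → ℝ} {S w L lam : ℝ}
    (hp : ∀ u, HasDerivAt p (p' u) u) (hp' : ∀ u, HasDerivAt p' (φ u - p u) u)
    (cφ : Continuous φ) (pos : ∀ u, 0 < p u) (φpos : ∀ u, 0 < φ u)
    (pper : Function.Periodic p π) (pper' : Function.Periodic p' π) (φper : Function.Periodic φ π)
    (hx : ∀ u, HasDerivAt x (g u * cos u) u) (hy : ∀ u, HasDerivAt y (g u * sin u) u)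
    (cg : Continuous g) (gpos : ∀ u, 0 < g u) (gper : Function.Periodic g (2 * π))
    (xper : Function.Periodic x (2 * π)) (yper : Function.Periodic y (2 * π))
    (hS : S = ∫ u in (0 : ℝ)..(2 * π), (x u * (g u * sin u) - y u * (g u * cos u)))
    (hw : w = ∫ u in (0 : ℝ)..(2 * π), p u * φ u)
    (hL : L = ∫ u in (0 : ℝ)..(2 * π), p u * g u)
    (hlam : lam = ∫ u in (0 : ℝ)..(2 * π), p u * φ u ^ 2 / g u) :
    S * w ≤ L ^ 2 ∧ w * L ≤ lam * S := by
  have cx : Continuous x := continuous_iff_continuousAt.2 fun u => (hx u).continuousAt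
  have cy : Continuous y := continuous_iff_continuousAt.2 fun u => (hy u).continuousAt
  have cp : Continuous p := continuous_iff_continuousAt.2 fun u => (hp u).continuousAt
  have Spos : 0 < S := hS ▸ area_pos hx hy cg gpos xper yper
  obtain ⟨a, ha⟩ := exists_bisecting_chord hx hy cg xper yper
  rw [← hS] at ha
  -- Seen from the chord's midpoint, the position vectors at `a` and `a + π` are opposite, as are
  -- the tangents, so `h` and `h'` agree at the two parameters.
  set x₀ := (x a + x (a + π)) / 2 with hx₀
  set y₀ := (y a + y (a + π)) / 2 with hy₀
  set h : ℝ → ℝ := fun u => (x u - x₀) * sin u - (y u - y₀) * cos u with hh_def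
  set h' : ℝ → ℝ := fun u => (x u - x₀) * cos u + (y u - y₀) * sin u with hh'_def
  have hh : ∀ u, HasDerivAt h (h' u) u := fun u =>
    ((((hx u).sub_const x₀).mul (hasDerivAt_sin u)).sub
      (((hy u).sub_const y₀).mul (hasDerivAt_cos u))).congr_deriv (by simp only [hh'_def]; ring)
  have hh' : ∀ u, HasDerivAt h' (g u - h u) u := fun u =>
    ((((hx u).sub_const x₀).mul (hasDerivAt_cos u)).add
      (((hy u).sub_const y₀).mul (hasDerivAt_sin u))).congr_deriv (by
        simp only [hh_def]; linear_combination g u * sin_sq_add_cos_sq u)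
  have ch : Continuous h := by fun_prop
  have hper : Function.Periodic h (2 * π) := fun u => by
    simp only [hh_def, xper u, yper u, sin_add_two_pi, cos_add_two_pi]
  have hper' : Function.Periodic h' (2 * π) := fun u => by
    simp only [hh'_def, xper u, yper u, sin_add_two_pi, cos_add_two_pi]
  have bh : h (a + π) = h a := by
    simp only [hh_def, sin_add_pi, cos_add_pi, hx₀, hy₀]; ring
  have bh' : h' (a + π) = h' a := by
    simp only [hh'_def, sin_add_pi, cos_add_pi, hx₀, hy₀]; ring
  have e2 : a + π + π = a + 2 * π := by ring
  have cQ : Continuous fun u => h u ^ 2 * g u / p u := by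
    fun_prop (disch := exact fun u => (pos u).ne')
  -- splitting the integral of a periodic function into the two halves
  have split : ∀ f : ℝ → ℝ, Continuous f → Function.Periodic f (2 * π) →
      ∫ u in (0:ℝ)..(2 * π), f u =
        (∫ u in a..(a + π), f u) + ∫ u in (a + π)..(a + π + π), f u := by
    intro f cf fper
    rw [intervalIntegral.integral_add_adjacent_intervals (cf.intervalIntegrable _ _)
      (cf.intervalIntegrable _ _), e2]
    simpa using fper.intervalIntegral_add_eq 0 a
  have p2per : Function.Periodic p (2 * π) := by simpa using pper.nat_mul 2
  have φ2per : Function.Periodic φ (2 * π) := by simpa using φper.nat_mul 2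
  have H1 := half_inequalities (a := a) hp hp' hh hh' cφ cg pos gpos φpos (pper a) (pper' a) bh bh'
  have H2 := half_inequalities (a := a + π) hp hp' hh hh' cφ cg pos gpos φpos (pper _) (pper' _)
    (by rw [e2, hper a, bh]) (by rw [e2, hper' a, bh'])
  have S1 : ∫ u in a..(a + π), h u * g u = S / 2 := by
    rw [← ha, integral_support_mul hx hy cg]; simp only [hx₀, hy₀]; ring
  have S0 : ∫ u in (0:ℝ)..(2 * π), h u * g u = S := by
    have x2 : x (2 * π) = x 0 := by simpa using xper 0
    have y2 : y (2 * π) = y 0 := by simpa using yper 0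
    rw [integral_support_mul hx hy cg, x2, y2, hS]; simp
  have S2 : ∫ u in (a + π)..(a + π + π), h u * g u = S / 2 := by
    have := split (fun u => h u * g u) (by fun_prop) (hper.mul gper)
    linarith
  have w12 : ∫ u in (a + π)..(a + π + π), p u * φ u = ∫ u in a..(a + π), p u * φ u :=
    (pper.mul φper).intervalIntegral_add_eq _ _
  have ws := split (fun u => p u * φ u) (by fun_prop) (p2per.mul φ2per)
  have w1 : ∫ u in a..(a + π), p u * φ u = w / 2 := by linarith
  have Ls := split (fun u => p u * g u) (by fun_prop) (p2per.mul gper)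
  have Qs := split (fun u => h u ^ 2 * g u / p u) cQ
    (fun u => by simp only [hper u, gper u, p2per u])
  rw [w12] at H2
  rw [S1, w1] at H1
  rw [S2, w1] at H2
  have l1 : 0 ≤ ∫ u in a..(a + π), p u * g u :=
    intervalIntegral.integral_nonneg (by linarith [pi_pos]) fun u _ => (mul_pos (pos u) (gpos u)).le
  have l2 : 0 ≤ ∫ u in (a + π)..(a + π + π), p u * g u :=
    intervalIntegral.integral_nonneg (by linarith [pi_pos]) fun u _ => (mul_pos (pos u) (gpos u)).le
  have wnn : 0 ≤ w := by
    rw [hw]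
    exact intervalIntegral.integral_nonneg (by positivity) fun u _ => (mul_pos (pos u) (φpos u)).le
  rw [← hL] at Ls
  set L1 := ∫ u in a..(a + π), p u * g u
  set L2 := ∫ u in (a + π)..(a + π + π), p u * g u
  constructor
  · have hk : 0 ≤ S / 2 * (w / 2) := by positivity
    -- The geometric mean of the two half inequalities supplies the cross term of `(L1 + L2)²`.
    have : S / 2 * (w / 2) ≤ L1 * L2 := by
      refine le_of_sq_le_sq ?_ (mul_nonneg l1 l2)
      calc (S / 2 * (w / 2)) ^ 2 = (S / 2 * (w / 2)) * (S / 2 * (w / 2)) := sq _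
        _ ≤ L1 ^ 2 * L2 ^ 2 := mul_le_mul H1.1 H2.1 hk (sq_nonneg _)
        _ = (L1 * L2) ^ 2 := by ring
    rw [Ls]; linarith [H1.1, H2.1]
  · set Q := ∫ u in (0:ℝ)..(2 * π), h u ^ 2 * g u / p u
    have hQ : w * Q ≤ S * L := by rw [Qs, Ls]; linarith [H1.2, H2.2]
    have IL : ∫ u in (0:ℝ)..(2 * π), h u * φ u = L := by
      have p2per' : Function.Periodic p' (2 * π) := by simpa using pper'.nat_mul 2
      rw [hL]
      exact integral_mul_eq_integral_mul hp hp' hh hh' cφ cg (by simpa using p2per 0)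
        (by simpa using p2per' 0) (by simpa using hper 0) (by simpa using hper' 0)
    -- Cauchy–Schwarz as a nonnegative square: `lam - 2 c L + c² Q ≥ 0`. With `Q ≤ S L / w`, the
    -- value `c = w / S` is optimal.
    set c := w / S with hc
    have hnn : 0 ≤ ∫ u in (0:ℝ)..(2 * π), (p u * φ u ^ 2 / g u - 2 * c * (h u * φ u) +
        c ^ 2 * (h u ^ 2 * g u / p u)) := by
      refine intervalIntegral.integral_nonneg (by positivity) fun u _ => ?_
      have : p u * φ u ^ 2 / g u - 2 * c * (h u * φ u) + c ^ 2 * (h u ^ 2 * g u / p u) =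
          p u / g u * (φ u - c * h u * g u / p u) ^ 2 := by
        field_simp [(pos u).ne', (gpos u).ne']; ring
      rw [this]
      exact mul_nonneg (div_pos (pos u) (gpos u)).le (sq_nonneg _)
    have i1 : IntervalIntegrable (fun u => p u * φ u ^ 2 / g u) MeasureTheory.volume 0 (2 * π) :=
      Continuous.intervalIntegrable (by fun_prop (disch := exact fun u => (gpos u).ne')) _ _
    have i2 : IntervalIntegrable (fun u => h u * φ u) MeasureTheory.volume 0 (2 * π) :=
      Continuous.intervalIntegrable (by fun_prop) _ _
    have i3 : IntervalIntegrable (fun u => h u ^ 2 * g u / p u) MeasureTheory.volume 0 (2 * π) :=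
      cQ.intervalIntegrable _ _
    rw [intervalIntegral.integral_add (i1.sub (i2.const_mul _)) (i3.const_mul _),
      intervalIntegral.integral_sub i1 (i2.const_mul _), intervalIntegral.integral_const_mul,
      intervalIntegral.integral_const_mul, IL, ← hlam] at hnn
    change 0 ≤ lam - 2 * c * L + c ^ 2 * Q at hnn
    have hcS : c * S = w := by rw [hc]; field_simp
    have cnn : 0 ≤ c := by positivity
    have e1 : c ^ 2 * Q * S ≤ c * (S * L) := by
      calc c ^ 2 * Q * S = c * (w * Q) := by rw [← hcS]; ring
        _ ≤ _ := mul_le_mul_of_nonneg_left hQ cnn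
    have e3 := mul_nonneg hnn Spos.le
    rw [← hcS]
    linarith
-- Geometric quantities as integrals over the tangential angle.
namespace IsAnisotropy

variable {p : ℝ → ℝ} (hp : IsAnisotropy p)
include hp

theorem hasDerivAt (u : ℝ) : HasDerivAt p (deriv p u) u :=
  (hp.smooth.differentiable (by simp) u).hasDerivAt

theorem contDiff_deriv : ContDiff ℝ ∞ (deriv p) :=
  (contDiff_infty_iff_deriv.1 hp.smooth).2

theorem hasDerivAt_deriv (u : ℝ) : HasDerivAt (deriv p) (anisoFunction p u - p u) u := by
  have := (hp.contDiff_deriv.differentiable (by simp) u).hasDerivAt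
  simpa [anisoFunction] using this

theorem contDiff_anisoFunction : ContDiff ℝ ∞ (anisoFunction p) :=
  ((contDiff_infty_iff_deriv.1 hp.contDiff_deriv).2).add hp.smooth

theorem anisoFunction_pos (u : ℝ) : 0 < anisoFunction p u := hp.strictConvex u

end IsAnisotropy

theorem periodic_deriv {p : ℝ → ℝ} {c : ℝ} (h : Function.Periodic p c) :
    Function.Periodic (deriv p) c := fun u => by
  rw [← deriv_comp_add_const, h.funext]

theorem periodic_anisoFunction {p : ℝ → ℝ} {c : ℝ} (h : Function.Periodic p c) :
    Function.Periodic (anisoFunction p) c :=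
  (periodic_deriv (periodic_deriv h)).add h

/-- The principal argument differs from `u` by a multiple of `2π`, which periodicity absorbs. -/
theorem periodic_comp_tangentAngle {f : ℝ → ℝ} (hf : Function.Periodic f (2 * π)) {γ : ℝ → ℂ}
    {u : ℝ} (hu : unitTangent γ u = Complex.exp (u * Complex.I)) :
    f (tangentAngle γ u) = f u := by
  rw [tangentAngle, hu, Complex.arg_exp_mul_I, toIocMod]
  exact hf.sub_zsmul_eq _

namespace IsConvexByAngle

variable {γ : ℝ → ℂ} (hγ : IsConvexByAngle γ)
include hγ

theorem speed_pos (u : ℝ) : 0 < speed γ u := norm_pos_iff.2 (hγ.regular u)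

theorem deriv_eq (u : ℝ) : deriv γ u = speed γ u • Complex.exp (u * Complex.I) := by
  rw [← hγ.tangent u, unitTangent, smul_inv_smul₀ (hγ.speed_pos u).ne']

theorem hasDerivAt (u : ℝ) :
    HasDerivAt γ (speed γ u • Complex.exp (u * Complex.I)) u := by
  rw [← hγ.deriv_eq]
  exact (hγ.smooth.differentiable (by simp) u).hasDerivAt

theorem hasDerivAt_re (u : ℝ) : HasDerivAt (fun u => (γ u).re) (speed γ u * cos u) u := by
  refine (Complex.reCLM.hasFDerivAt.comp_hasDerivAt u (hγ.hasDerivAt u)).congr_deriv ?_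
  simp [Complex.exp_ofReal_mul_I_re]

theorem hasDerivAt_im (u : ℝ) : HasDerivAt (fun u => (γ u).im) (speed γ u * sin u) u := by
  refine (Complex.imCLM.hasFDerivAt.comp_hasDerivAt u (hγ.hasDerivAt u)).congr_deriv ?_
  simp [Complex.exp_ofReal_mul_I_im]

theorem continuous_speed : Continuous (speed γ) :=
  (hγ.smooth.continuous_deriv (by simp)).norm

theorem periodic_speed : Function.Periodic (speed γ) (2 * π) := fun u => by
  simp only [speed]
  rw [← deriv_comp_add_const, hγ.periodic.funext]

theorem curvature_eq (u : ℝ) : curvature γ u = (speed γ u)⁻¹ := by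
  have h1 : unitTangent γ = fun θ : ℝ => Complex.exp (θ * Complex.I) := funext hγ.tangent
  have h2 : HasDerivAt (fun θ : ℝ => Complex.exp (θ * Complex.I))
      (Complex.exp (u * Complex.I) * (1 * Complex.I)) u :=
    ((Complex.ofRealCLM.hasDerivAt (x := u)).mul_const Complex.I).cexp
  rw [curvature, unitNormal, h1, h2.deriv, one_mul, mul_comm Complex.I, real_inner_self_eq_norm_sq]
  simp [Complex.norm_exp_ofReal_mul_I]

theorem enclosedArea_eq : enclosedArea γ = (1 / 2) * ∫ u in (0 : ℝ)..(2 * π),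
    ((γ u).re * (speed γ u * sin u) - (γ u).im * (speed γ u * cos u)) := by
  simp only [enclosedArea, hγ.deriv_eq, Complex.smul_re, Complex.smul_im, smul_eq_mul,
    Complex.exp_ofReal_mul_I_re, Complex.exp_ofReal_mul_I_im]

variable {p : ℝ → ℝ} (hp : IsAnisotropy p)
include hp

theorem anisoLength_eq : anisoLength p γ = ∫ u in (0 : ℝ)..(2 * π), p u * speed γ u := by
  simp only [anisoLength, periodic_comp_tangentAngle hp.periodic (hγ.tangent _)]

theorem anisoCurvature_eq (u : ℝ) : anisoCurvature p γ u = anisoFunction p u / speed γ u := by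
  rw [anisoCurvature, hγ.curvature_eq,
    periodic_comp_tangentAngle (periodic_anisoFunction hp.periodic) (hγ.tangent _), div_eq_mul_inv]

theorem nonlocalTerm_eq : nonlocalTerm p γ =
    ∫ u in (0 : ℝ)..(2 * π), p u * anisoFunction p u ^ 2 / speed γ u := by
  simp only [nonlocalTerm, hγ.anisoCurvature_eq hp,
    periodic_comp_tangentAngle hp.periodic (hγ.tangent _)]
  congr 1; ext u
  have := (hγ.speed_pos u).ne'
  field_simp

theorem normalSpeed_eq (u : ℝ) : normalSpeed p γ u =
    p u * (anisoFunction p u / speed γ u - nonlocalTerm p γ / (2 * wulffArea p)) := by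
  rw [normalSpeed, hγ.anisoCurvature_eq hp, periodic_comp_tangentAngle hp.periodic (hγ.tangent _)]

end IsConvexByAngle

/-- The Wulff curve has support function `p` and derivative `φ e^{iθ}`, so `φ` is its speed. -/
theorem IsAnisotropy.wulffArea_eq {p : ℝ → ℝ} (hp : IsAnisotropy p) :
    wulffArea p = (1 / 2) * ∫ u in (0 : ℝ)..(2 * π), p u * anisoFunction p u := by
  have hd : ∀ u : ℝ, deriv (wulffCurve p) u =
      anisoFunction p u • Complex.exp (u * Complex.I) := by
    intro u
    have h2 : HasDerivAt (fun θ : ℝ => Complex.exp (θ * Complex.I))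
        (Complex.exp (u * Complex.I) * (1 * Complex.I)) u :=
      ((Complex.ofRealCLM.hasDerivAt (x := u)).mul_const Complex.I).cexp
    have h3 := ((hp.hasDerivAt u).smul (h2.const_mul Complex.I)).neg.add
      ((hp.hasDerivAt_deriv u).smul h2)
    have h4 : HasDerivAt (wulffCurve p) _ u := h3
    rw [h4.deriv]
    simp only [Complex.real_smul, Complex.ofReal_sub]
    linear_combination (-(p u : ℂ) * Complex.exp (u * Complex.I)) * Complex.I_sq
  rw [wulffArea, enclosedArea]
  congr 2
  ext u
  rw [hd, wulffCurve]
  simp only [Complex.add_re, Complex.add_im, Complex.neg_re, Complex.neg_im, Complex.smul_re,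
    Complex.smul_im, Complex.mul_re, Complex.mul_im, Complex.I_re, Complex.I_im,
    Complex.exp_ofReal_mul_I_re, Complex.exp_ofReal_mul_I_im, smul_eq_mul]
  linear_combination (p u * anisoFunction p u) * sin_sq_add_cos_sq u

theorem IsAnisotropy.wulffArea_pos {p : ℝ → ℝ} (hp : IsAnisotropy p) : 0 < wulffArea p := by
  rw [hp.wulffArea_eq]
  have h1 := hp.smooth.continuous
  have h2 := hp.contDiff_anisoFunction.continuous
  have : 0 < ∫ u in (0 : ℝ)..(2 * π), p u * anisoFunction p u :=
    intervalIntegral.intervalIntegral_pos_of_pos (Continuous.intervalIntegrable (by fun_prop) _ _)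
      (fun u => mul_pos (hp.pos u) (hp.anisoFunction_pos u)) (by positivity)
  linarith

namespace IsConvexByAngle

variable {γ : ℝ → ℂ} (hγ : IsConvexByAngle γ)
include hγ

theorem enclosedArea_pos : 0 < enclosedArea γ := by
  rw [hγ.enclosedArea_eq]
  have := area_pos hγ.hasDerivAt_re hγ.hasDerivAt_im hγ.continuous_speed hγ.speed_pos
    (hγ.periodic.comp Complex.re) (hγ.periodic.comp Complex.im)
  linarith

variable {p : ℝ → ℝ} (hp : IsAnisotropy p)
include hp

theorem anisoLength_pos : 0 < anisoLength p γ := by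
  rw [hγ.anisoLength_eq hp]
  have h1 := hp.smooth.continuous
  have h2 := hγ.continuous_speed
  exact intervalIntegral.intervalIntegral_pos_of_pos
    (Continuous.intervalIntegrable (by fun_prop) _ _)
    (fun u => mul_pos (hp.pos u) (hγ.speed_pos u)) (by positivity)

/-- The anisotropic isoperimetric inequality and the anisotropic Gage inequality. -/
theorem isoperimetric_and_gage (hsymm : Function.Periodic p π) :
    4 * enclosedArea γ * wulffArea p ≤ anisoLength p γ ^ 2 ∧
    wulffArea p * anisoLength p γ ≤ nonlocalTerm p γ * enclosedArea γ := by
  have := gage_inequalities hp.hasDerivAt hp.hasDerivAt_deriv hp.contDiff_anisoFunction.continuous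
    hp.pos hp.anisoFunction_pos hsymm (periodic_deriv hsymm) (periodic_anisoFunction hsymm)
    hγ.hasDerivAt_re hγ.hasDerivAt_im hγ.continuous_speed hγ.speed_pos hγ.periodic_speed
    (hγ.periodic.comp Complex.re) (hγ.periodic.comp Complex.im) rfl rfl
    (hγ.anisoLength_eq hp) (hγ.nonlocalTerm_eq hp)
  have hA := hγ.enclosedArea_eq
  have hW := hp.wulffArea_eq
  set S := ∫ u in (0 : ℝ)..(2 * π),
    ((γ u).re * (speed γ u * sin u) - (γ u).im * (speed γ u * cos u))
  set w := ∫ u in (0 : ℝ)..(2 * π), p u * anisoFunction p u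
  have hS' : S = 2 * enclosedArea γ := by linarith
  have hw' : w = 2 * wulffArea p := by linarith
  change S * w ≤ _ ∧ w * _ ≤ _ * S at this
  rw [hS', hw'] at this
  constructor <;> linarith [this.1, this.2]

end IsConvexByAngle
-- Calculus on the strip `S × ℝ` and uniqueness for a transport equation.
variable {E : Type*} [NormedAddCommGroup E] [NormedSpace ℝ E]

/-- The partial derivative of `F (t, u)` in `u`, for `t ∈ S`. -/
noncomputable def dSpace (S : Set ℝ) (F : ℝ × ℝ → E) (q : ℝ × ℝ) : E :=
  fderivWithin ℝ F (S ×ˢ univ) q (0, 1)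

/-- The partial derivative of `F (t, u)` in `t`, within `S`. -/
noncomputable def dTime (S : Set ℝ) (F : ℝ × ℝ → E) (q : ℝ × ℝ) : E :=
  fderivWithin ℝ F (S ×ˢ univ) q (1, 0)

section Calculus

variable {S : Set ℝ} {F : ℝ × ℝ → E}

theorem contDiffOn_dSpace (hS : UniqueDiffOn ℝ S) (hF : ContDiffOn ℝ ∞ F (S ×ˢ univ)) :
    ContDiffOn ℝ ∞ (dSpace S F) (S ×ˢ univ) :=
  (hF.fderivWithin (hS.prod uniqueDiffOn_univ) (by simp)).clm_apply contDiffOn_const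

theorem contDiffOn_dTime (hS : UniqueDiffOn ℝ S) (hF : ContDiffOn ℝ ∞ F (S ×ˢ univ)) :
    ContDiffOn ℝ ∞ (dTime S F) (S ×ˢ univ) :=
  (hF.fderivWithin (hS.prod uniqueDiffOn_univ) (by simp)).clm_apply contDiffOn_const

theorem contDiff_slice (hF : ContDiffOn ℝ ∞ F (S ×ˢ univ)) {t : ℝ} (ht : t ∈ S) :
    ContDiff ℝ ∞ fun u => F (t, u) :=
  contDiffOn_univ.1 (hF.comp (contDiff_prodMk_right t).contDiffOn fun _ _ => ⟨ht, mem_univ _⟩)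

theorem hasDerivAt_dSpace (hF : ContDiffOn ℝ ∞ F (S ×ˢ univ)) {t : ℝ} (ht : t ∈ S) (u : ℝ) :
    HasDerivAt (fun u => F (t, u)) (dSpace S F (t, u)) u := by
  have h1 := (hF.differentiableOn (by simp) (t, u) ⟨ht, mem_univ _⟩).hasFDerivWithinAt
  have h2 : HasDerivWithinAt (fun u : ℝ => (t, u)) ((0 : ℝ), (1 : ℝ)) univ u :=
    (hasDerivWithinAt_const u univ t).prodMk (hasDerivWithinAt_id u univ)
  exact hasDerivWithinAt_univ.1 (h1.comp_hasDerivWithinAt u h2 fun _ _ => ⟨ht, mem_univ _⟩)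

theorem hasDerivWithinAt_dTime (hF : ContDiffOn ℝ ∞ F (S ×ˢ univ)) {t : ℝ} (ht : t ∈ S) (u : ℝ) :
    HasDerivWithinAt (fun t => F (t, u)) (dTime S F (t, u)) S t := by
  have h1 := (hF.differentiableOn (by simp) (t, u) ⟨ht, mem_univ _⟩).hasFDerivWithinAt
  have h2 : HasDerivWithinAt (fun t : ℝ => (t, u)) ((1 : ℝ), (0 : ℝ)) S t :=
    (hasDerivWithinAt_id t S).prodMk (hasDerivWithinAt_const t S u)
  exact HasFDerivWithinAt.comp_hasDerivWithinAt (t := S ×ˢ univ) t h1 h2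
    fun _ hs => ⟨hs, mem_univ _⟩

theorem hasDerivAt_dTime (hF : ContDiffOn ℝ ∞ F (S ×ˢ univ)) {t : ℝ} (ht : t ∈ interior S)
    (u : ℝ) : HasDerivAt (fun t => F (t, u)) (dTime S F (t, u)) t :=
  (hasDerivWithinAt_dTime hF (interior_subset ht) u).hasDerivAt (mem_interior_iff_mem_nhds.1 ht)

/-- Equality of mixed partial derivatives. -/
theorem dTime_dSpace (hS : UniqueDiffOn ℝ S) (hF : ContDiffOn ℝ ∞ F (S ×ˢ univ)) {t : ℝ}
    (ht : t ∈ interior S) (u : ℝ) : dTime S (dSpace S F) (t, u) = dSpace S (dTime S F) (t, u) := by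
  have hm : (t, u) ∈ S ×ˢ (univ : Set ℝ) := ⟨interior_subset ht, mem_univ _⟩
  have hU := hS.prod (uniqueDiffOn_univ (𝕜 := ℝ) (E := ℝ))
  have hint : (t, u) ∈ interior (S ×ˢ (univ : Set ℝ)) := by
    rw [interior_prod_eq, interior_univ]; exact ⟨ht, mem_univ _⟩
  have hsym : IsSymmSndFDerivWithinAt ℝ F (S ×ˢ univ) (t, u) :=
    (hF _ hm).isSymmSndFDerivWithinAt
      (by rw [minSmoothness_of_isRCLikeNormedField]; exact WithTop.coe_le_coe.2 le_top) hU (subset_closure hint) hm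
  have hd : DifferentiableWithinAt ℝ (fderivWithin ℝ F (S ×ˢ univ)) (S ×ˢ univ) (t, u) :=
    (hF.fderivWithin hU (m := ∞) (by simp)).differentiableOn (by simp) _ hm
  have h1 : ∀ v w : ℝ × ℝ, fderivWithin ℝ (fun q => fderivWithin ℝ F (S ×ˢ univ) q v)
      (S ×ˢ univ) (t, u) w = fderivWithin ℝ (fderivWithin ℝ F (S ×ˢ univ)) (S ×ˢ univ) (t, u) w v := by
    intro v w
    rw [fderivWithin_clm_apply (hU _ hm) hd (differentiableWithinAt_const v)]
    simp
  exact (h1 _ _).trans ((hsym _ _).trans (h1 _ _).symm)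

theorem dSpace_periodic (hF : ContDiffOn ℝ ∞ F (S ×ˢ univ)) {c t : ℝ} (ht : t ∈ S)
    (h : ∀ u, F (t, u + c) = F (t, u)) (u : ℝ) : dSpace S F (t, u + c) = dSpace S F (t, u) := by
  have h1 := (hasDerivAt_dSpace hF ht (u + c)).comp_add_const u c
  simp only [h] at h1
  exact h1.unique (hasDerivAt_dSpace hF ht u)

theorem dTime_periodic (hS : UniqueDiffOn ℝ S) (hF : ContDiffOn ℝ ∞ F (S ×ˢ univ)) {c t : ℝ}
    (ht : t ∈ S) (h : ∀ t ∈ S, ∀ u, F (t, u + c) = F (t, u)) (u : ℝ) :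
    dTime S F (t, u + c) = dTime S F (t, u) :=
  (hS t ht).eq_deriv S ((hasDerivWithinAt_dTime hF ht (u + c)).congr
    (fun s hs => (h s hs u).symm) (h t ht u).symm) (hasDerivWithinAt_dTime hF ht u)

theorem continuousOn_integral {F : ℝ × ℝ → ℝ} (hF : ContinuousOn F (S ×ˢ univ)) (a b : ℝ) :
    ContinuousOn (fun t => ∫ u in a..b, F (t, u)) S := by
  rw [continuousOn_iff_continuous_domRestrict]
  have hc : Continuous (fun q : S × ℝ => F (q.1, q.2)) :=
    hF.comp_continuous (by fun_prop) fun q => ⟨q.1.2, mem_univ _⟩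
  exact intervalIntegral.continuous_parametric_intervalIntegral_of_continuous'
    (f := fun (t : S) u => F (t, u)) (μ := MeasureTheory.volume) hc a b

theorem hasDerivAt_integral (hS : UniqueDiffOn ℝ S) {F : ℝ × ℝ → ℝ}
    (hF : ContDiffOn ℝ ∞ F (S ×ˢ univ)) {a b t : ℝ} (ht : t ∈ interior S) :
    HasDerivAt (fun t => ∫ u in a..b, F (t, u)) (∫ u in a..b, dTime S F (t, u)) t := by
  obtain ⟨ε, hε, hball⟩ := Metric.nhds_basis_closedBall.mem_iff.1 (isOpen_interior.mem_nhds ht)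
  have hcd := (contDiffOn_dTime hS hF).continuousOn
  obtain ⟨C, hC⟩ := ((isCompact_closedBall t ε).prod (isCompact_uIcc (a := a) (b := b))
    ).exists_bound_of_continuousOn (hcd.mono
      (prod_mono (hball.trans interior_subset) (subset_univ _)))
  have hslice : ∀ {G : ℝ × ℝ → ℝ}, ContinuousOn G (S ×ˢ univ) → ∀ s ∈ S,
      Continuous fun u => G (s, u) := fun hG s hs =>
    hG.comp_continuous (by fun_prop) fun _ => ⟨hs, mem_univ _⟩
  have hnhds : Metric.closedBall t ε ∈ 𝓝 t := Metric.closedBall_mem_nhds t hε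
  refine (intervalIntegral.hasDerivAt_integral_of_dominated_loc_of_deriv_le
    (F := fun t u => F (t, u)) (F' := fun t u => dTime S F (t, u)) (bound := fun _ => C)
    hnhds ?_ ?_ ?_ ?_ (by simp) ?_).2
  · filter_upwards [hnhds] with s hs
    exact (hslice hF.continuousOn s (interior_subset (hball hs))).aestronglyMeasurable
  · exact (hslice hF.continuousOn t (interior_subset ht)).intervalIntegrable _ _
  · exact (hslice hcd t (interior_subset ht)).aestronglyMeasurable
  · exact Eventually.of_forall fun u hu s hs => hC (s, u) ⟨hs, uIoc_subset_uIcc hu⟩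
  · exact Eventually.of_forall fun u hu s hs => hasDerivAt_dTime hF (hball hs) u

/-- A smooth nonnegative function transported by a periodic vector field vanishes identically if
it does so initially. -/
theorem eq_zero_of_transport (hS : UniqueDiffOn ℝ S) (hconv : Convex ℝ S) (h0 : (0 : ℝ) ∈ S)
    (hnn : ∀ t ∈ S, 0 ≤ t) {f c : ℝ × ℝ → ℝ} {P : ℝ} (hP : 0 < P)
    (hf : ContDiffOn ℝ ∞ f (S ×ˢ univ)) (hc : ContDiffOn ℝ ∞ c (S ×ˢ univ))
    (fper : ∀ t ∈ S, ∀ u, f (t, u + P) = f (t, u)) (cper : ∀ t ∈ S, ∀ u, c (t, u + P) = c (t, u))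
    (fnn : ∀ t ∈ S, ∀ u, 0 ≤ f (t, u)) (finit : ∀ u, f (0, u) = 0)
    (heq : ∀ t ∈ interior S, ∀ u, dTime S f (t, u) = -(c (t, u) * dSpace S f (t, u))) :
    ∀ t ∈ S, ∀ u, f (t, u) = 0 := by
  intro t₁ ht₁
  have hI : Icc 0 t₁ ⊆ S := by
    rw [← segment_eq_Icc (hnn _ ht₁)]; exact hconv.segment_subset h0 ht₁
  have hdc := contDiffOn_dSpace hS hc
  have hdf := contDiffOn_dSpace hS hf
  obtain ⟨C, hC⟩ := ((isCompact_Icc (a := 0) (b := t₁)).prod (isCompact_Icc (a := 0) (b := P))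
    ).exists_bound_of_continuousOn (hdc.continuousOn.mono (prod_mono hI (subset_univ _)))
  have hslice : ∀ {G : ℝ × ℝ → ℝ}, ContDiffOn ℝ ∞ G (S ×ˢ univ) → ∀ s ∈ S,
      Continuous fun u => G (s, u) := fun hG s hs => (contDiff_slice hG hs).continuous
  -- Grönwall for the integral over a period: integration by parts moves the space derivative from
  -- `f` to `c`, and `∂c/∂u` is at most `C` on `[0, t₁] × [0, P]`.
  set Φ : ℝ → ℝ := fun t => ∫ u in (0:ℝ)..P, f (t, u) with hΦ
  have hΦ' : ∀ t ∈ Ioo 0 t₁, ∃ d, HasDerivAt Φ d t ∧ d ≤ C * Φ t := by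
    intro t ht
    have htS : t ∈ S := hI (Ioo_subset_Icc_self ht)
    have hti : t ∈ interior S := by
      have := interior_mono hI; rw [interior_Icc] at this; exact this ht
    refine ⟨_, hasDerivAt_integral hS hf hti, ?_⟩
    have hparts : ∫ u in (0:ℝ)..P, (dSpace S c (t, u) * f (t, u) + c (t, u) * dSpace S f (t, u)) =
        0 := by
      rw [intervalIntegral.integral_eq_sub_of_hasDerivAt (f := fun u => c (t, u) * f (t, u))
        (fun u _ => (hasDerivAt_dSpace hc htS u).mul (hasDerivAt_dSpace hf htS u))]
      · have h1 := fper t htS 0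
        have h2 := cper t htS 0
        rw [zero_add] at h1 h2
        rw [h1, h2, sub_self]
      · exact (((hslice hdc t htS).mul (hslice hf t htS)).add
          ((hslice hc t htS).mul (hslice hdf t htS))).intervalIntegrable _ _
    have i1 : IntervalIntegrable (fun u => dSpace S c (t, u) * f (t, u)) MeasureTheory.volume 0 P :=
      ((hslice hdc t htS).mul (hslice hf t htS)).intervalIntegrable _ _
    have i2 : IntervalIntegrable (fun u => c (t, u) * dSpace S f (t, u)) MeasureTheory.volume 0 P :=
      ((hslice hc t htS).mul (hslice hdf t htS)).intervalIntegrable _ _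
    rw [intervalIntegral.integral_add i1 i2] at hparts
    simp_rw [heq t hti]
    rw [intervalIntegral.integral_neg, hΦ, ← intervalIntegral.integral_const_mul]
    have : ∫ u in (0:ℝ)..P, dSpace S c (t, u) * f (t, u) ≤ ∫ u in (0:ℝ)..P, C * f (t, u) := by
      refine intervalIntegral.integral_mono_on hP.le i1
        (((hslice hf t htS).const_mul C).intervalIntegrable _ _) fun u hu => ?_
      exact mul_le_mul_of_nonneg_right
        ((le_abs_self _).trans (hC (t, u) ⟨Ioo_subset_Icc_self ht, hu⟩)) (fnn t htS u)
    linarith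
  have hanti : AntitoneOn (fun t => exp (-(C * t)) * Φ t) (Icc 0 t₁) := by
    have hder : ∀ t ∈ Ioo 0 t₁, ∃ d, HasDerivAt (fun t => exp (-(C * t)) * Φ t) d t ∧ d ≤ 0 := by
      intro t ht
      obtain ⟨d, hd, hle⟩ := hΦ' t ht
      refine ⟨_, (((hasDerivAt_id t).const_mul C).neg.exp).mul hd, ?_⟩
      have := exp_pos (-(C * t))
      simp only [Pi.neg_apply, mul_one, id_eq]
      linarith [mul_le_mul_of_nonneg_left hle this.le]
    refine antitoneOn_of_deriv_nonpos (convex_Icc _ _) ?_ ?_ ?_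
    · exact ContinuousOn.mul (by fun_prop) ((continuousOn_integral hf.continuousOn 0 P).mono hI)
    · intro t ht
      rw [interior_Icc] at ht
      obtain ⟨d, hd, -⟩ := hder t ht
      exact hd.differentiableAt.differentiableWithinAt
    · intro t ht
      rw [interior_Icc] at ht
      obtain ⟨d, hd, hle⟩ := hder t ht
      rwa [hd.deriv]
  have ht0 : 0 ≤ t₁ := hnn _ ht₁
  have h1 := hanti (left_mem_Icc.2 ht0) (right_mem_Icc.2 ht0) ht0
  have h2 : Φ 0 = 0 := by simp [hΦ, finit]
  simp only [h2, mul_zero] at h1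
  have h3 : Φ t₁ ≤ 0 := by
    have := exp_pos (-(C * t₁))
    by_contra! h
    exact absurd h1 (not_le.2 (mul_pos this h))
  have hz : ∀ u ∈ Icc 0 P, f (t₁, u) = 0 := by
    intro u hu
    by_contra hne
    have hpos : 0 < f (t₁, u) := lt_of_le_of_ne (fnn _ ht₁ u) (Ne.symm hne)
    have := intervalIntegral.integral_pos hP (hslice hf t₁ ht₁).continuousOn
      (fun x _ => fnn t₁ ht₁ x) ⟨u, hu, hpos⟩
    exact absurd h3 (not_le.2 this)
  intro u
  have hper : Function.Periodic (fun u => f (t₁, u)) P := fper t₁ ht₁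
  obtain ⟨y, hy, hyu⟩ := hper.exists_mem_Ico₀ hP u
  exact hyu.trans (hz y (Ico_subset_Icc_self hy))

end Calculus
-- The flow preserves the tangential angle.
section TimeInterval

variable {T : EReal}

theorem zero_mem_timeInterval (hT : 0 < T) : (0 : ℝ) ∈ timeInterval T := ⟨le_rfl, by simpa using hT⟩

theorem convex_timeInterval (T : EReal) : Convex ℝ (timeInterval T) := by
  refine OrdConnected.convex ⟨fun a ha b hb c hc => ⟨ha.1.trans hc.1, ?_⟩⟩
  exact lt_of_le_of_lt (EReal.coe_le_coe_iff.2 hc.2) hb.2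

theorem uniqueDiffOn_timeInterval (hT : 0 < T) : UniqueDiffOn ℝ (timeInterval T) := by
  obtain ⟨b, hb, hbT⟩ := EReal.lt_iff_exists_real_btwn.1 hT
  refine uniqueDiffOn_convex (convex_timeInterval T) ⟨b / 2, ?_⟩
  have hb0 : 0 < b := by exact_mod_cast hb
  refine mem_interior.2 ⟨Ioo 0 b, fun t ht => ⟨ht.1.le, ?_⟩, isOpen_Ioo, by constructor <;> linarith⟩
  exact (EReal.coe_lt_coe_iff.2 ht.2).trans hbT

end TimeInterval

/-- If a family of curves `(x, y)` with unit tangent `(a, b)` and speed `g` moves with normal speed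
`V` and tangential speed `ξ = -∂V/∂u`, then the tangential angle is independent of time once `u` is
the tangential angle initially. -/
theorem tangent_preserved {S : Set ℝ} (hS : UniqueDiffOn ℝ S) (hconv : Convex ℝ S)
    (h0 : (0 : ℝ) ∈ S) (hnn : ∀ t ∈ S, 0 ≤ t) {x y g a b ξ V : ℝ × ℝ → ℝ}
    (hx : ContDiffOn ℝ ∞ x (S ×ˢ univ)) (hy : ContDiffOn ℝ ∞ y (S ×ˢ univ))
    (hg : ContDiffOn ℝ ∞ g (S ×ˢ univ)) (ha : ContDiffOn ℝ ∞ a (S ×ˢ univ))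
    (hb : ContDiffOn ℝ ∞ b (S ×ˢ univ)) (hξ : ContDiffOn ℝ ∞ ξ (S ×ˢ univ))
    (hV : ContDiffOn ℝ ∞ V (S ×ˢ univ))
    (gpos : ∀ t ∈ S, ∀ u, 0 < g (t, u)) (unit : ∀ t ∈ S, ∀ u, a (t, u) ^ 2 + b (t, u) ^ 2 = 1)
    (xu : ∀ t ∈ S, ∀ u, dSpace S x (t, u) = g (t, u) * a (t, u))
    (yu : ∀ t ∈ S, ∀ u, dSpace S y (t, u) = g (t, u) * b (t, u))
    (xt : ∀ t ∈ S, ∀ u, dTime S x (t, u) = ξ (t, u) * a (t, u) - V (t, u) * b (t, u))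
    (yt : ∀ t ∈ S, ∀ u, dTime S y (t, u) = ξ (t, u) * b (t, u) + V (t, u) * a (t, u))
    (Vu : ∀ t ∈ S, ∀ u, dSpace S V (t, u) = -ξ (t, u))
    (gper : ∀ t ∈ S, ∀ u, g (t, u + 2 * π) = g (t, u))
    (aper : ∀ t ∈ S, ∀ u, a (t, u + 2 * π) = a (t, u))
    (bper : ∀ t ∈ S, ∀ u, b (t, u + 2 * π) = b (t, u))
    (ξper : ∀ t ∈ S, ∀ u, ξ (t, u + 2 * π) = ξ (t, u))
    (a0 : ∀ u, a (0, u) = cos u) (b0 : ∀ u, b (0, u) = sin u) :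
    ∀ t ∈ S, ∀ u, a (t, u) = cos u ∧ b (t, u) = sin u := by
  have hcos : ContDiffOn ℝ ∞ (fun q : ℝ × ℝ => cos q.2) (S ×ˢ univ) :=
    (contDiff_cos.comp contDiff_snd).contDiffOn
  have hsin : ContDiffOn ℝ ∞ (fun q : ℝ × ℝ => sin q.2) (S ×ˢ univ) :=
    (contDiff_sin.comp contDiff_snd).contDiffOn
  -- The squared distance from the unit tangent to `e^{iu}` avoids choosing a continuous angle.
  set f : ℝ × ℝ → ℝ := fun q => (a q - cos q.2) ^ 2 + (b q - sin q.2) ^ 2 with hf_def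
  have hf : ContDiffOn ℝ ∞ f (S ×ˢ univ) := ((ha.sub hcos).pow 2).add ((hb.sub hsin).pow 2)
  set c : ℝ × ℝ → ℝ := fun q => -(ξ q / g q) with hc_def
  have hc : ContDiffOn ℝ ∞ c (S ×ˢ univ) :=
    (hξ.div hg (fun q hq => (gpos q.1 hq.1 q.2).ne')).neg
  have hz := eq_zero_of_transport hS hconv h0 hnn two_pi_pos hf hc
    (fun t ht u => by simp only [hf_def, aper t ht, bper t ht, cos_add_two_pi, sin_add_two_pi])
    (fun t ht u => by simp only [hc_def, ξper t ht, gper t ht])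
    (fun t ht u => by positivity) (fun u => by simp [hf_def, a0, b0]) ?_
  · intro t ht u
    have h1 := hz t ht u
    simp only [hf_def] at h1
    have h2 := sq_nonneg (a (t, u) - cos u)
    have h3 := sq_nonneg (b (t, u) - sin u)
    have h4 : (a (t, u) - cos u) ^ 2 = 0 := by linarith
    have h5 : (b (t, u) - sin u) ^ 2 = 0 := by linarith
    exact ⟨sub_eq_zero.1 (pow_eq_zero_iff two_ne_zero |>.1 h4),
      sub_eq_zero.1 (pow_eq_zero_iff two_ne_zero |>.1 h5)⟩
  intro t hti u
  have ht := interior_subset hti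
  have uS := hS t ht
  have au := hasDerivAt_dSpace ha ht u
  have bu := hasDerivAt_dSpace hb ht u
  have atm := hasDerivWithinAt_dTime ha ht u
  have btm := hasDerivWithinAt_dTime hb ht u
  have gt := hasDerivWithinAt_dTime hg ht u
  have ξu := hasDerivAt_dSpace hξ ht u
  have Vu' := hasDerivAt_dSpace hV ht u
  -- the mixed derivatives of `x` and `y`, computed in two ways
  have ex : dTime S g (t, u) * a (t, u) + g (t, u) * dTime S a (t, u) =
      dSpace S ξ (t, u) * a (t, u) + ξ (t, u) * dSpace S a (t, u) -
        (dSpace S V (t, u) * b (t, u) + V (t, u) * dSpace S b (t, u)) := by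
    have e1 := uS.eq_deriv S (hasDerivWithinAt_dTime (contDiffOn_dSpace hS hx) ht u)
      ((gt.mul atm).congr (fun s hs => xu s hs u) (xu t ht u))
    have e2 := (hasDerivAt_dSpace (contDiffOn_dTime hS hx) ht u).unique
      (((ξu.mul au).sub (Vu'.mul bu)).congr_of_eventuallyEq
        (Eventually.of_forall fun v => xt t ht v))
    rw [← e1, ← e2, dTime_dSpace hS hx hti]
  have ey : dTime S g (t, u) * b (t, u) + g (t, u) * dTime S b (t, u) =
      dSpace S ξ (t, u) * b (t, u) + ξ (t, u) * dSpace S b (t, u) +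
        (dSpace S V (t, u) * a (t, u) + V (t, u) * dSpace S a (t, u)) := by
    have e1 := uS.eq_deriv S (hasDerivWithinAt_dTime (contDiffOn_dSpace hS hy) ht u)
      ((gt.mul btm).congr (fun s hs => yu s hs u) (yu t ht u))
    have e2 := (hasDerivAt_dSpace (contDiffOn_dTime hS hy) ht u).unique
      (((ξu.mul bu).add (Vu'.mul au)).congr_of_eventuallyEq
        (Eventually.of_forall fun v => yt t ht v))
    rw [← e1, ← e2, dTime_dSpace hS hy hti]
  have eu : a (t, u) * dSpace S a (t, u) + b (t, u) * dSpace S b (t, u) = 0 := by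
    have := ((au.pow 2).add (bu.pow 2)).unique ((hasDerivAt_const u (1 : ℝ)).congr_of_eventuallyEq
      (Eventually.of_forall fun v => unit t ht v))
    simp at this
    linarith
  have et : a (t, u) * dTime S a (t, u) + b (t, u) * dTime S b (t, u) = 0 := by
    have := uS.eq_deriv S ((atm.pow 2).add (btm.pow 2)) ((hasDerivWithinAt_const t S (1 : ℝ)).congr
      (fun s hs => unit s hs u) (unit t ht u))
    simp at this
    linarith
  have fu := (hasDerivAt_dSpace hf ht u).unique
    (((au.sub (hasDerivAt_cos u)).pow 2).add ((bu.sub (hasDerivAt_sin u)).pow 2))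
  have ft := uS.eq_deriv S (hasDerivWithinAt_dTime hf ht u)
    (((atm.sub_const (cos u)).pow 2).add ((btm.sub_const (sin u)).pow 2))
  rw [fu, ft, hc_def]
  have g0 := (gpos t ht u).ne'
  have un := unit t ht u
  rw [Vu t ht u] at ex ey
  generalize dSpace S a (t, u) = a₁ at *
  generalize dSpace S b (t, u) = b₁ at *
  generalize dTime S a (t, u) = a₂ at *
  generalize dTime S b (t, u) = b₂ at *
  simp only [Pi.sub_apply, Nat.cast_ofNat, Nat.add_one_sub_one, pow_one]
  generalize a (t, u) = A at *
  generalize b (t, u) = B at *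
  -- With `τ = a + ib`, the mixed derivatives and `|τ| = 1` give `g τ_t = ξ (τ_u - iτ)`. Replacing
  -- `iτ` by `i e^{iu}` is harmless in `f_t`, since `i(τ - e^{iu})` is orthogonal to `τ - e^{iu}`;
  -- hence `g f_t = ξ f_u`.
  have ka : g (t, u) * a₂ = ξ (t, u) * (a₁ + B) := by
    linear_combination B * (B * ex - A * ey) + g (t, u) * A * et - V (t, u) * B * eu -
      (g (t, u) * a₂ - ξ (t, u) * B) * un + ξ (t, u) * (a₁ * un - A * eu)
  have kb : g (t, u) * b₂ = ξ (t, u) * (b₁ - A) := by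
    linear_combination -A * (B * ex - A * ey) + g (t, u) * B * et + V (t, u) * A * eu -
      (g (t, u) * b₂ + ξ (t, u) * A) * un + ξ (t, u) * (b₁ * un - B * eu)
  field_simp
  linear_combination (A - cos u) * ka + (B - sin u) * kb
theorem re_sq_add_im_sq_div_norm {z : ℂ} (hz : z ≠ 0) :
    (z.re / ‖z‖) ^ 2 + (z.im / ‖z‖) ^ 2 = 1 := by
  have h1 : ‖z‖ ≠ 0 := norm_ne_zero_iff.2 hz
  have h2 := Complex.sq_norm z
  rw [Complex.normSq_apply] at h2
  field_simp
  linarith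

theorem unitTangent_re (γ : ℝ → ℂ) (u : ℝ) :
    (unitTangent γ u).re = (deriv γ u).re / ‖deriv γ u‖ := by
  rw [unitTangent, Complex.smul_re, smul_eq_mul, speed, inv_mul_eq_div]

theorem unitTangent_im (γ : ℝ → ℂ) (u : ℝ) :
    (unitTangent γ u).im = (deriv γ u).im / ‖deriv γ u‖ := by
  rw [unitTangent, Complex.smul_im, smul_eq_mul, speed, inv_mul_eq_div]

namespace IsFlow

variable {p : ℝ → ℝ} {X₀ : ℝ → ℂ} {T : EReal} {X : ℝ → ℝ → ℂ} (hX : IsFlow p X₀ T X)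
include hX

theorem contDiffOn_re : ContDiffOn ℝ ∞ (fun q : ℝ × ℝ => (X q.1 q.2).re)
    (timeInterval T ×ˢ univ) := Complex.reCLM.contDiff.comp_contDiffOn hX.smooth

theorem contDiffOn_im : ContDiffOn ℝ ∞ (fun q : ℝ × ℝ => (X q.1 q.2).im)
    (timeInterval T ×ˢ univ) := Complex.imCLM.contDiff.comp_contDiffOn hX.smooth

theorem dSpace_eq {t : ℝ} (ht : t ∈ timeInterval T) (u : ℝ) :
    dSpace (timeInterval T) (fun q : ℝ × ℝ => X q.1 q.2) (t, u) = deriv (X t) u :=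
  (hasDerivAt_dSpace hX.smooth ht u).deriv.symm

theorem dSpace_re {t : ℝ} (ht : t ∈ timeInterval T) (u : ℝ) :
    dSpace (timeInterval T) (fun q : ℝ × ℝ => (X q.1 q.2).re) (t, u) = (deriv (X t) u).re := by
  rw [← hX.dSpace_eq ht]
  exact (hasDerivAt_dSpace hX.contDiffOn_re ht u).unique
    (Complex.reCLM.hasFDerivAt.comp_hasDerivAt u (hasDerivAt_dSpace hX.smooth ht u))

theorem dSpace_im {t : ℝ} (ht : t ∈ timeInterval T) (u : ℝ) :
    dSpace (timeInterval T) (fun q : ℝ × ℝ => (X q.1 q.2).im) (t, u) = (deriv (X t) u).im := by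
  rw [← hX.dSpace_eq ht]
  exact (hasDerivAt_dSpace hX.contDiffOn_im ht u).unique
    (Complex.imCLM.hasFDerivAt.comp_hasDerivAt u (hasDerivAt_dSpace hX.smooth ht u))

theorem dTime_re (hT : 0 < T) {t : ℝ} (ht : t ∈ timeInterval T) (u : ℝ) :
    dTime (timeInterval T) (fun q : ℝ × ℝ => (X q.1 q.2).re) (t, u) =
      -deriv (normalSpeed p (X t)) u * (unitTangent (X t) u).re -
        normalSpeed p (X t) u * (unitTangent (X t) u).im := by
  have h1 := Complex.reCLM.hasFDerivAt.comp_hasDerivWithinAt t (hX.evolution t ht u)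
  rw [(uniqueDiffOn_timeInterval hT t ht).eq_deriv _
    (hasDerivWithinAt_dTime hX.contDiffOn_re ht u) h1]
  simp [unitNormal]
  ring

theorem dTime_im (hT : 0 < T) {t : ℝ} (ht : t ∈ timeInterval T) (u : ℝ) :
    dTime (timeInterval T) (fun q : ℝ × ℝ => (X q.1 q.2).im) (t, u) =
      -deriv (normalSpeed p (X t)) u * (unitTangent (X t) u).im +
        normalSpeed p (X t) u * (unitTangent (X t) u).re := by
  have h1 := Complex.imCLM.hasFDerivAt.comp_hasDerivWithinAt t (hX.evolution t ht u)
  rw [(uniqueDiffOn_timeInterval hT t ht).eq_deriv _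
    (hasDerivWithinAt_dTime hX.contDiffOn_im ht u) h1]
  simp [unitNormal]

/-- Along the flow `u` remains the tangential angle; in particular the curves stay convex. -/
theorem isConvexByAngle (hT : 0 < T) (hX₀ : IsConvexByAngle X₀) {t : ℝ}
    (ht : t ∈ timeInterval T) : IsConvexByAngle (X t) := by
  set S := timeInterval T with hS_def
  have hS : UniqueDiffOn ℝ S := uniqueDiffOn_timeInterval hT
  have hx := hX.contDiffOn_re
  have hy := hX.contDiffOn_im
  set F : ℝ × ℝ → ℂ := fun q => X q.1 q.2
  set x : ℝ × ℝ → ℝ := fun q => (X q.1 q.2).re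
  set y : ℝ × ℝ → ℝ := fun q => (X q.1 q.2).im
  have hFu : ContDiffOn ℝ ∞ (dSpace S F) (S ×ˢ univ) := contDiffOn_dSpace hS hX.smooth
  have hne : ∀ t ∈ S, ∀ u, dSpace S F (t, u) ≠ 0 := fun t ht u => by
    rw [hX.dSpace_eq ht]; exact hX.regular t ht u
  set g : ℝ × ℝ → ℝ := fun q => ‖dSpace S F q‖ with hg_def
  have hg : ContDiffOn ℝ ∞ g (S ×ˢ univ) := hFu.norm ℝ fun q hq => hne q.1 hq.1 q.2
  have gpos : ∀ t ∈ S, ∀ u, 0 < g (t, u) := fun t ht u => norm_pos_iff.2 (hne t ht u)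
  have gne : ∀ q ∈ S ×ˢ (univ : Set ℝ), g q ≠ 0 := fun q hq => (gpos q.1 hq.1 q.2).ne'
  set a : ℝ × ℝ → ℝ := fun q => (dSpace S F q).re / g q with ha_def
  set b : ℝ × ℝ → ℝ := fun q => (dSpace S F q).im / g q with hb_def
  have ha : ContDiffOn ℝ ∞ a (S ×ˢ univ) :=
    (Complex.reCLM.contDiff.comp_contDiffOn hFu).div hg gne
  have hb : ContDiffOn ℝ ∞ b (S ×ˢ univ) :=
    (Complex.imCLM.contDiff.comp_contDiffOn hFu).div hg gne
  have a_eq : ∀ t ∈ S, ∀ u, a (t, u) = (unitTangent (X t) u).re := fun t ht u => by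
    simp only [ha_def, hg_def]; rw [hX.dSpace_eq ht, unitTangent_re]
  have b_eq : ∀ t ∈ S, ∀ u, b (t, u) = (unitTangent (X t) u).im := fun t ht u => by
    simp only [hb_def, hg_def]; rw [hX.dSpace_eq ht, unitTangent_im]
  have unit : ∀ t ∈ S, ∀ u, a (t, u) ^ 2 + b (t, u) ^ 2 = 1 := fun t ht u =>
    re_sq_add_im_sq_div_norm (hne t ht u)
  have hxt := contDiffOn_dTime hS hx
  have hyt := contDiffOn_dTime hS hy
  -- Reading both speeds off the velocity makes them smooth and periodic before convexity is known,
  -- when `tangentAngle` may still jump.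
  set ξ : ℝ × ℝ → ℝ := fun q => dTime S x q * a q + dTime S y q * b q with hξ_def
  set V : ℝ × ℝ → ℝ := fun q => dTime S y q * a q - dTime S x q * b q with hV_def
  have xt : ∀ t ∈ S, ∀ u, dTime S x (t, u) =
      -deriv (normalSpeed p (X t)) u * a (t, u) - normalSpeed p (X t) u * b (t, u) :=
    fun t ht u => by rw [a_eq t ht, b_eq t ht]; exact hX.dTime_re hT ht u
  have yt : ∀ t ∈ S, ∀ u, dTime S y (t, u) =
      -deriv (normalSpeed p (X t)) u * b (t, u) + normalSpeed p (X t) u * a (t, u) :=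
    fun t ht u => by rw [a_eq t ht, b_eq t ht]; exact hX.dTime_im hT ht u
  have ξ_eq : ∀ t ∈ S, ∀ u, ξ (t, u) = -deriv (normalSpeed p (X t)) u := fun t ht u => by
    simp only [hξ_def]; rw [xt t ht, yt t ht]
    linear_combination (-deriv (normalSpeed p (X t)) u) * unit t ht u
  have V_eq : ∀ t ∈ S, ∀ u, V (t, u) = normalSpeed p (X t) u := fun t ht u => by
    simp only [hV_def]; rw [xt t ht, yt t ht]
    linear_combination (normalSpeed p (X t) u) * unit t ht u
  have hV : ContDiffOn ℝ ∞ V (S ×ˢ univ) := (hyt.mul ha).sub (hxt.mul hb)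
  have Fper : ∀ t ∈ S, ∀ u, dSpace S F (t, u + 2 * π) = dSpace S F (t, u) := fun t ht =>
    dSpace_periodic hX.smooth ht (hX.periodic t ht)
  have aper : ∀ t ∈ S, ∀ u, a (t, u + 2 * π) = a (t, u) := fun t ht u => by
    simp only [ha_def, hg_def, Fper t ht]
  have bper : ∀ t ∈ S, ∀ u, b (t, u + 2 * π) = b (t, u) := fun t ht u => by
    simp only [hb_def, hg_def, Fper t ht]
  have xtper : ∀ t ∈ S, ∀ u, dTime S x (t, u + 2 * π) = dTime S x (t, u) := fun t ht =>
    dTime_periodic hS hx ht fun t ht u => congrArg Complex.re (hX.periodic t ht u)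
  have ytper : ∀ t ∈ S, ∀ u, dTime S y (t, u + 2 * π) = dTime S y (t, u) := fun t ht =>
    dTime_periodic hS hy ht fun t ht u => congrArg Complex.im (hX.periodic t ht u)
  have zS : (0 : ℝ) ∈ S := zero_mem_timeInterval hT
  have main := tangent_preserved hS (convex_timeInterval T) zS (fun t ht => ht.1) hx hy hg ha hb
    ((hxt.mul ha).add (hyt.mul hb)) hV gpos unit
    (fun t ht u => by
      rw [mul_div_cancel₀ _ (gpos t ht u).ne', hX.dSpace_eq ht]; exact hX.dSpace_re ht u)
    (fun t ht u => by
      rw [mul_div_cancel₀ _ (gpos t ht u).ne', hX.dSpace_eq ht]; exact hX.dSpace_im ht u)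
    (fun t ht u => by
      change dTime S x (t, u) = ξ (t, u) * a (t, u) - V (t, u) * b (t, u)
      rw [ξ_eq t ht, V_eq t ht, xt t ht])
    (fun t ht u => by
      change dTime S y (t, u) = ξ (t, u) * b (t, u) + V (t, u) * a (t, u)
      rw [ξ_eq t ht, V_eq t ht, yt t ht])
    (fun t ht u => by
      change dSpace S V (t, u) = -ξ (t, u)
      rw [ξ_eq t ht, neg_neg, ← (hasDerivAt_dSpace hV ht u).deriv]
      exact congrArg (fun f => deriv f u) (funext fun v => V_eq t ht v))
    (fun t ht u => by simp only [hg_def, Fper t ht]) aper bper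
    (fun t ht u => by simp only [xtper t ht, ytper t ht, aper t ht, bper t ht])
    (fun u => by
      rw [a_eq 0 zS, hX.initial, hX₀.tangent, Complex.exp_ofReal_mul_I_re])
    (fun u => by
      rw [b_eq 0 zS, hX.initial, hX₀.tangent, Complex.exp_ofReal_mul_I_im])
  refine ⟨contDiff_slice hX.smooth ht, hX.periodic t ht, hX.regular t ht, fun u => ?_⟩
  obtain ⟨h1, h2⟩ := main t ht u
  apply Complex.ext
  · rw [← a_eq t ht, h1, Complex.exp_ofReal_mul_I_re]
  · rw [← b_eq t ht, h2, Complex.exp_ofReal_mul_I_im]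

end IsFlow
-- First variation of length and area through the support function.
namespace IsConvexByAngle

variable {γ : ℝ → ℂ} (hγ : IsConvexByAngle γ)
include hγ

theorem contDiff_speed : ContDiff ℝ ∞ (speed γ) :=
  ((contDiff_infty_iff_deriv.1 hγ.smooth).2).norm ℝ hγ.regular

/-- The support function `γ.re sin - γ.im cos` has derivative `γ.re cos + γ.im sin`. -/
theorem hasDerivAt_support (u : ℝ) :
    HasDerivAt (fun u => (γ u).re * sin u - (γ u).im * cos u)
      ((γ u).re * cos u + (γ u).im * sin u) u :=
  (((hγ.hasDerivAt_re u).mul (hasDerivAt_sin u)).sub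
    ((hγ.hasDerivAt_im u).mul (hasDerivAt_cos u))).congr_deriv (by ring)

theorem hasDerivAt_deriv_support (u : ℝ) :
    HasDerivAt (fun u => (γ u).re * cos u + (γ u).im * sin u)
      (speed γ u - ((γ u).re * sin u - (γ u).im * cos u)) u :=
  (((hγ.hasDerivAt_re u).mul (hasDerivAt_cos u)).add
    ((hγ.hasDerivAt_im u).mul (hasDerivAt_sin u))).congr_deriv (by
      linear_combination speed γ u * sin_sq_add_cos_sq u)

theorem endpoint_eq : γ (2 * π) = γ 0 := by simpa using hγ.periodic 0

/-- The speed is eliminated by parts, so differentiating in time needs only `h_t` and `h'_t`. -/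
theorem enclosedArea_eq_support : enclosedArea γ = ∫ u in (0 : ℝ)..(2 * π),
    (((γ u).re * sin u - (γ u).im * cos u) ^ 2 - ((γ u).re * cos u + (γ u).im * sin u) ^ 2) / 2 := by
  have c1 : Continuous fun u => (γ u).re := Complex.continuous_re.comp hγ.smooth.continuous
  have c2 : Continuous fun u => (γ u).im := Complex.continuous_im.comp hγ.smooth.continuous
  have c3 := hγ.continuous_speed
  have h0 : ∫ u in (0 : ℝ)..(2 * π), (((γ u).re * (speed γ u * sin u) -
      (γ u).im * (speed γ u * cos u)) / 2 - (((γ u).re * sin u - (γ u).im * cos u) ^ 2 -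
        ((γ u).re * cos u + (γ u).im * sin u) ^ 2) / 2) = 0 := by
    rw [intervalIntegral.integral_eq_sub_of_hasDerivAt (f := fun u =>
      ((γ u).re * sin u - (γ u).im * cos u) * ((γ u).re * cos u + (γ u).im * sin u) / 2)]
    · simp [hγ.endpoint_eq]
    · intro u _
      exact (((hγ.hasDerivAt_support u).mul (hγ.hasDerivAt_deriv_support u)).div_const 2
        ).congr_deriv (by ring)
    · exact Continuous.intervalIntegrable (by fun_prop) _ _
  rw [intervalIntegral.integral_sub (Continuous.intervalIntegrable (by fun_prop) _ _)
    (Continuous.intervalIntegrable (by fun_prop) _ _), intervalIntegral.integral_div] at h0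
  rw [hγ.enclosedArea_eq]
  linarith

variable {p : ℝ → ℝ} (hp : IsAnisotropy p)
include hp

/-- Symmetry of the mixed area puts the fixed weight `φ` against `h`, the only factor depending on
the curve. -/
theorem anisoLength_eq_support : anisoLength p γ =
    ∫ u in (0 : ℝ)..(2 * π), ((γ u).re * sin u - (γ u).im * cos u) * anisoFunction p u := by
  rw [hγ.anisoLength_eq hp]
  refine (integral_mul_eq_integral_mul hp.hasDerivAt hp.hasDerivAt_deriv hγ.hasDerivAt_support
    hγ.hasDerivAt_deriv_support hp.contDiff_anisoFunction.continuous hγ.continuous_speed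
    (by simpa using hp.periodic 0) (by simpa using periodic_deriv hp.periodic 0) ?_ ?_).symm
  all_goals simp [hγ.endpoint_eq]

theorem contDiff_normalSpeed : ContDiff ℝ ∞ (normalSpeed p γ) := by
  rw [funext (hγ.normalSpeed_eq hp)]
  exact hp.smooth.mul ((hp.contDiff_anisoFunction.div hγ.contDiff_speed
    fun u => (hγ.speed_pos u).ne').sub contDiff_const)

theorem periodic_normalSpeed : Function.Periodic (normalSpeed p γ) (2 * π) := fun u => by
  rw [hγ.normalSpeed_eq hp, hγ.normalSpeed_eq hp, hp.periodic u, hγ.periodic_speed u,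
    periodic_anisoFunction hp.periodic u]

/-- This integral is `-dL/dt` along the flow; the constant `λ/(2W)` is exactly what makes it vanish.
-/
theorem integral_anisoFunction_mul_normalSpeed :
    ∫ u in (0 : ℝ)..(2 * π), anisoFunction p u * normalSpeed p γ u = 0 := by
  have c1 := hp.contDiff_anisoFunction.continuous
  have c2 := hp.smooth.continuous
  have c3 := hγ.continuous_speed
  have W := hp.wulffArea_eq
  have Wpos := hp.wulffArea_pos
  have : ∀ u, anisoFunction p u * normalSpeed p γ u = p u * anisoFunction p u ^ 2 / speed γ u -
      nonlocalTerm p γ / (2 * wulffArea p) * (p u * anisoFunction p u) := fun u => by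
    rw [hγ.normalSpeed_eq hp]; ring
  simp_rw [this]
  rw [intervalIntegral.integral_sub (Continuous.intervalIntegrable
      (by fun_prop (disch := exact fun u => (hγ.speed_pos u).ne')) _ _)
    (Continuous.intervalIntegrable (by fun_prop) _ _), ← hγ.nonlocalTerm_eq hp,
    intervalIntegral.integral_const_mul,
    show ∫ u in (0 : ℝ)..(2 * π), p u * anisoFunction p u = 2 * wulffArea p by linarith]
  field_simp
  ring

theorem integral_speed_mul_normalSpeed :
    ∫ u in (0 : ℝ)..(2 * π), speed γ u * normalSpeed p γ u =
      2 * wulffArea p - nonlocalTerm p γ * anisoLength p γ / (2 * wulffArea p) := by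
  have c1 := hp.contDiff_anisoFunction.continuous
  have c2 := hp.smooth.continuous
  have c3 := hγ.continuous_speed
  have W := hp.wulffArea_eq
  have : ∀ u, speed γ u * normalSpeed p γ u = p u * anisoFunction p u -
      nonlocalTerm p γ / (2 * wulffArea p) * (p u * speed γ u) := fun u => by
    rw [hγ.normalSpeed_eq hp]
    have := (hγ.speed_pos u).ne'
    field_simp
  simp_rw [this]
  rw [intervalIntegral.integral_sub (Continuous.intervalIntegrable (by fun_prop) _ _)
    (Continuous.intervalIntegrable (by fun_prop) _ _),
    intervalIntegral.integral_const_mul, ← hγ.anisoLength_eq hp,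
    show ∫ u in (0 : ℝ)..(2 * π), p u * anisoFunction p u = 2 * wulffArea p by linarith]
  ring

/-- The rate of change of the enclosed area for normal speed `V` and tangential speed
`ξ = -∂V/∂u`. -/
theorem integral_area_variation :
    ∫ u in (0 : ℝ)..(2 * π), (-(((γ u).re * sin u - (γ u).im * cos u) * normalSpeed p γ u) +
      ((γ u).re * cos u + (γ u).im * sin u) * deriv (normalSpeed p γ) u) =
    nonlocalTerm p γ * anisoLength p γ / (2 * wulffArea p) - 2 * wulffArea p := by
  have hn := hγ.contDiff_normalSpeed hp
  have c1 : Continuous fun u => (γ u).re := Complex.continuous_re.comp hγ.smooth.continuous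
  have c2 : Continuous fun u => (γ u).im := Complex.continuous_im.comp hγ.smooth.continuous
  have c3 := hγ.continuous_speed
  have c4 := hn.continuous
  have c5 := hn.continuous_deriv (by simp)
  -- The integrand is `(h' V)'`, because `h'' = g - h`; the area variation is therefore `-∫ g V`.
  have h0 : ∫ u in (0 : ℝ)..(2 * π),
      (-(((γ u).re * sin u - (γ u).im * cos u) * normalSpeed p γ u) +
        ((γ u).re * cos u + (γ u).im * sin u) * deriv (normalSpeed p γ) u +
        speed γ u * normalSpeed p γ u) = 0 := by
    rw [intervalIntegral.integral_eq_sub_of_hasDerivAt (f := fun u =>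
      ((γ u).re * cos u + (γ u).im * sin u) * normalSpeed p γ u)]
    · have := hγ.periodic_normalSpeed hp 0
      rw [zero_add] at this
      simp [hγ.endpoint_eq, this]
    · intro u _
      exact ((hγ.hasDerivAt_deriv_support u).mul
        (hn.differentiable (by simp) u).hasDerivAt).congr_deriv (by ring)
    · exact Continuous.intervalIntegrable (by fun_prop) _ _
  rw [intervalIntegral.integral_add (Continuous.intervalIntegrable (by fun_prop) _ _)
    (Continuous.intervalIntegrable (by fun_prop) _ _),
    hγ.integral_speed_mul_normalSpeed hp] at h0
  linarith

end IsConvexByAngle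

/-! ### Evolution of length, area and deficit along the flow. -/

namespace IsFlow

variable {p : ℝ → ℝ} {X₀ : ℝ → ℂ} {T : EReal} {X : ℝ → ℝ → ℂ} (hX : IsFlow p X₀ T X)
  (hp : IsAnisotropy p) (hX₀ : IsConvexByAngle X₀) (hT : 0 < T)
include hX

theorem contDiffOn_support : ContDiffOn ℝ ∞
    (fun q : ℝ × ℝ => (X q.1 q.2).re * sin q.2 - (X q.1 q.2).im * cos q.2)
    (timeInterval T ×ˢ univ) :=
  (hX.contDiffOn_re.mul (contDiff_sin.comp contDiff_snd).contDiffOn).sub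
    (hX.contDiffOn_im.mul (contDiff_cos.comp contDiff_snd).contDiffOn)

theorem contDiffOn_deriv_support : ContDiffOn ℝ ∞
    (fun q : ℝ × ℝ => (X q.1 q.2).re * cos q.2 + (X q.1 q.2).im * sin q.2)
    (timeInterval T ×ˢ univ) :=
  (hX.contDiffOn_re.mul (contDiff_cos.comp contDiff_snd).contDiffOn).add
    (hX.contDiffOn_im.mul (contDiff_sin.comp contDiff_snd).contDiffOn)

include hX₀ hT

/-- The normal at parameter `u` is constant in time, so only the normal velocity counts; the sign
arises because `h` is measured along the outward normal. -/
theorem hasDerivWithinAt_support {t : ℝ} (ht : t ∈ timeInterval T) (u : ℝ) :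
    HasDerivWithinAt (fun t => (X t u).re * sin u - (X t u).im * cos u)
      (-normalSpeed p (X t) u) (timeInterval T) t := by
  refine (((hasDerivWithinAt_dTime hX.contDiffOn_re ht u).mul_const (sin u)).sub
    ((hasDerivWithinAt_dTime hX.contDiffOn_im ht u).mul_const (cos u))).congr_deriv ?_
  rw [hX.dTime_re hT ht, hX.dTime_im hT ht, (hX.isConvexByAngle hT hX₀ ht).tangent,
    Complex.exp_ofReal_mul_I_re, Complex.exp_ofReal_mul_I_im]
  linear_combination (-normalSpeed p (X t) u) * sin_sq_add_cos_sq u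

theorem hasDerivWithinAt_deriv_support {t : ℝ} (ht : t ∈ timeInterval T) (u : ℝ) :
    HasDerivWithinAt (fun t => (X t u).re * cos u + (X t u).im * sin u)
      (-deriv (normalSpeed p (X t)) u) (timeInterval T) t := by
  refine (((hasDerivWithinAt_dTime hX.contDiffOn_re ht u).mul_const (cos u)).add
    ((hasDerivWithinAt_dTime hX.contDiffOn_im ht u).mul_const (sin u))).congr_deriv ?_
  rw [hX.dTime_re hT ht, hX.dTime_im hT ht, (hX.isConvexByAngle hT hX₀ ht).tangent,
    Complex.exp_ofReal_mul_I_re, Complex.exp_ofReal_mul_I_im]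
  linear_combination (-deriv (normalSpeed p (X t)) u) * sin_sq_add_cos_sq u

theorem continuousOn_enclosedArea : ContinuousOn (fun t => enclosedArea (X t)) (timeInterval T) := by
  have hF := ((hX.contDiffOn_support.pow 2).sub (hX.contDiffOn_deriv_support.pow 2)).div_const 2
  exact (continuousOn_integral hF.continuousOn 0 (2 * π)).congr fun t ht =>
    (hX.isConvexByAngle hT hX₀ ht).enclosedArea_eq_support

include hp

theorem hasDerivAt_enclosedArea {t : ℝ} (ht : t ∈ interior (timeInterval T)) :
    HasDerivAt (fun t => enclosedArea (X t))
      (nonlocalTerm p (X t) * anisoLength p (X t) / (2 * wulffArea p) - 2 * wulffArea p) t := by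
  have hS := uniqueDiffOn_timeInterval hT
  have htS := interior_subset ht
  have hF := ((hX.contDiffOn_support.pow 2).sub (hX.contDiffOn_deriv_support.pow 2)).div_const 2
  have h1 := hasDerivAt_integral (a := 0) (b := 2 * π) hS hF ht
  refine (h1.congr_of_eventuallyEq ?_).congr_deriv ?_
  · filter_upwards [mem_interior_iff_mem_nhds.1 ht] with s hs
    exact (hX.isConvexByAngle hT hX₀ hs).enclosedArea_eq_support
  · rw [← (hX.isConvexByAngle hT hX₀ htS).integral_area_variation hp]
    congr 1
    ext u
    rw [(hS t htS).eq_deriv _ (hasDerivWithinAt_dTime hF htS u)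
      ((((hX.hasDerivWithinAt_support hX₀ hT htS u).pow 2).sub
        ((hX.hasDerivWithinAt_deriv_support hX₀ hT htS u).pow 2)).div_const 2)]
    simp
    ring

/-- The anisotropic length is preserved by the flow. -/
theorem anisoLength_eq {t : ℝ} (ht : t ∈ timeInterval T) :
    anisoLength p (X t) = anisoLength p X₀ := by
  have hS := uniqueDiffOn_timeInterval hT
  have hF := hX.contDiffOn_support.mul
    (hp.contDiff_anisoFunction.comp (contDiff_snd (E := ℝ) (F := ℝ))).contDiffOn
  have hd : ∀ s ∈ interior (timeInterval T), HasDerivAt (fun t => anisoLength p (X t)) 0 s := by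
    intro s hs
    have hsS := interior_subset hs
    refine ((hasDerivAt_integral (a := 0) (b := 2 * π) hS hF hs).congr_of_eventuallyEq
      ?_).congr_deriv ?_
    · filter_upwards [mem_interior_iff_mem_nhds.1 hs] with r hr
      exact (hX.isConvexByAngle hT hX₀ hr).anisoLength_eq_support hp
    · refine Eq.trans ?_ (neg_eq_zero.2
        ((hX.isConvexByAngle hT hX₀ hsS).integral_anisoFunction_mul_normalSpeed hp))
      rw [← intervalIntegral.integral_neg]
      congr 1
      ext u
      rw [(hS s hsS).eq_deriv _ (hasDerivWithinAt_dTime hF hsS u)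
        ((hX.hasDerivWithinAt_support hX₀ hT hsS u).mul_const (anisoFunction p u))]
      ring
  have hc : ContinuousOn (fun t => anisoLength p (X t)) (timeInterval T) :=
    (continuousOn_integral hF.continuousOn 0 (2 * π)).congr fun t ht =>
      (hX.isConvexByAngle hT hX₀ ht).anisoLength_eq_support hp
  have hdiff : DifferentiableOn ℝ (fun t => anisoLength p (X t)) (interior (timeInterval T)) :=
    fun s hs => (hd s hs).differentiableAt.differentiableWithinAt
  have h0 := zero_mem_timeInterval hT
  -- The derivative is known only at interior times; continuity carries constancy back to `t = 0`.
  have hmono := monotoneOn_of_deriv_nonneg (convex_timeInterval T) hc hdiff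
    (fun s hs => (hd s hs).deriv.ge)
  have hanti := antitoneOn_of_deriv_nonpos (convex_timeInterval T) hc hdiff
    (fun s hs => (hd s hs).deriv.le)
  rw [← hX.initial]
  exact le_antisymm (hanti h0 ht ht.1) (hmono h0 ht ht.1)

theorem anisoDeficit_eq {t : ℝ} (ht : t ∈ timeInterval T) : anisoDeficit p (X t) =
    anisoLength p X₀ ^ 2 / (4 * enclosedArea (X t) * wulffArea p) - 1 := by
  rw [anisoDeficit, hX.anisoLength_eq hp hX₀ hT ht]

theorem continuousOn_anisoDeficit :
    ContinuousOn (fun t => anisoDeficit p (X t)) (timeInterval T) := by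
  refine ContinuousOn.congr ?_ fun t ht => hX.anisoDeficit_eq hp hX₀ hT ht
  refine ContinuousOn.sub (ContinuousOn.div continuousOn_const ?_ fun t ht => ?_) continuousOn_const
  · exact (continuousOn_const.mul (hX.continuousOn_enclosedArea hX₀ hT)).mul continuousOn_const
  · have := (hX.isConvexByAngle hT hX₀ ht).enclosedArea_pos
    have := hp.wulffArea_pos
    positivity

theorem anisoDeficit_nonneg (hsymm : Function.Periodic p π) {t : ℝ} (ht : t ∈ timeInterval T) :
    0 ≤ anisoDeficit p (X t) := by
  have hγ := hX.isConvexByAngle hT hX₀ ht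
  have hA := hγ.enclosedArea_pos
  have hW := hp.wulffArea_pos
  rw [anisoDeficit, sub_nonneg, one_le_div (by positivity)]
  exact (hγ.isoperimetric_and_gage hp hsymm).1

/-- The differential inequality for the anisoperimetric deficit. -/
theorem exists_hasDerivAt_anisoDeficit (hsymm : Function.Periodic p π) {t : ℝ}
    (ht : t ∈ interior (timeInterval T)) :
    ∃ d, HasDerivAt (fun t => anisoDeficit p (X t)) d t ∧
      d ≤ -(8 * wulffArea p ^ 2 / anisoLength p X₀ ^ 2) * anisoDeficit p (X t) := by
  have htS := interior_subset ht
  have hγ := hX.isConvexByAngle hT hX₀ htS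
  have hA := hγ.enclosedArea_pos
  have hW := hp.wulffArea_pos
  have hL := hX₀.anisoLength_pos hp
  obtain ⟨iso, gage⟩ := hγ.isoperimetric_and_gage hp hsymm
  have hd := (((hasDerivAt_const t (anisoLength p X₀ ^ 2)).div
    (((hX.hasDerivAt_enclosedArea hp hX₀ hT ht).const_mul 4).mul_const (wulffArea p))
    (by positivity)).sub_const 1)
  refine ⟨_, hd.congr_of_eventuallyEq ?_, ?_⟩
  · filter_upwards [mem_interior_iff_mem_nhds.1 ht] with s hs
    exact hX.anisoDeficit_eq hp hX₀ hT hs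
  rw [hX.anisoDeficit_eq hp hX₀ hT htS]
  rw [hX.anisoLength_eq hp hX₀ hT htS] at iso gage ⊢
  generalize anisoLength p X₀ = L at *
  generalize enclosedArea (X t) = A at *
  generalize wulffArea p = W at *
  generalize nonlocalTerm p (X t) = l at *
  -- Gage's inequality times `L`: the lower bound for `A'`.
  have h1 : (L ^ 2 - 4 * A * W) / (2 * A) ≤ l * L / (2 * W) - 2 * W := by
    have : L ^ 2 / (2 * A) ≤ l * L / (2 * W) := by
      rw [div_le_div_iff₀ (by positivity) (by positivity)]
      linarith [mul_le_mul_of_nonneg_left gage hL.le]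
    have e : (L ^ 2 - 4 * A * W) / (2 * A) = L ^ 2 / (2 * A) - 2 * W := by field_simp; ring
    linarith
  generalize l * L / (2 * W) - 2 * W = A' at *
  -- The squared isoperimetric inequality trades the varying area for the constant length, which
  -- produces the rate `8W²/L²`.
  have h2 : (4 * A * W) ^ 2 ≤ (L ^ 2) ^ 2 := pow_le_pow_left₀ (by positivity) iso 2
  have h3 : 2 * W / (A * L ^ 2) ≤ L ^ 2 / (8 * A ^ 3 * W) := by
    rw [div_le_div_iff₀ (by positivity) (by positivity)]
    linarith [mul_le_mul_of_nonneg_left h2 hA.le]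
  have h4 : 2 * W / (A * L ^ 2) * (L ^ 2 - 4 * A * W) ≤ L ^ 2 / (4 * A ^ 2 * W) * A' :=
    calc 2 * W / (A * L ^ 2) * (L ^ 2 - 4 * A * W)
        ≤ L ^ 2 / (8 * A ^ 3 * W) * (L ^ 2 - 4 * A * W) :=
          mul_le_mul_of_nonneg_right h3 (by linarith)
      _ = L ^ 2 / (4 * A ^ 2 * W) * ((L ^ 2 - 4 * A * W) / (2 * A)) := by field_simp; ring
      _ ≤ _ := mul_le_mul_of_nonneg_left h1 (by positivity)
  have e1 : (0 * (4 * A * W) - L ^ 2 * (4 * A' * W)) / (4 * A * W) ^ 2 =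
      -(L ^ 2 / (4 * A ^ 2 * W) * A') := by field_simp; ring
  have e2 : -(8 * W ^ 2 / L ^ 2) * (L ^ 2 / (4 * A * W) - 1) =
      -(2 * W / (A * L ^ 2) * (L ^ 2 - 4 * A * W)) := by field_simp; ring
  rw [e1, e2]
  exact neg_le_neg h4

/-- The exponentially weighted anisoperimetric deficit is nonincreasing, for every rate up to the
one in the differential inequality. -/
theorem antitoneOn_exp_mul_anisoDeficit (hsymm : Function.Periodic p π) {c : ℝ}
    (hc : c ≤ 8 * wulffArea p ^ 2 / anisoLength p X₀ ^ 2) :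
    AntitoneOn (fun t => exp (c * t) * anisoDeficit p (X t)) (timeInterval T) := by
  have hder : ∀ t ∈ interior (timeInterval T),
      ∃ d, HasDerivAt (fun t => exp (c * t) * anisoDeficit p (X t)) d t ∧ d ≤ 0 := by
    intro t ht
    obtain ⟨d, hd, hle⟩ := hX.exists_hasDerivAt_anisoDeficit hp hX₀ hT hsymm ht
    refine ⟨_, (((hasDerivAt_id t).const_mul c).exp).mul hd, ?_⟩
    have hD := hX.anisoDeficit_nonneg hp hX₀ hT hsymm (interior_subset ht)
    have h1 : d ≤ -c * anisoDeficit p (X t) :=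
      hle.trans (mul_le_mul_of_nonneg_right (neg_le_neg hc) hD)
    have := mul_le_mul_of_nonneg_left h1 (exp_pos (c * t)).le
    simp only [mul_one, id_eq]
    linarith
  refine antitoneOn_of_deriv_nonpos (convex_timeInterval T) ?_ ?_ ?_
  · exact ContinuousOn.mul (by fun_prop) (hX.continuousOn_anisoDeficit hp hX₀ hT)
  · intro t ht
    obtain ⟨d, hd, -⟩ := hder t ht
    exact hd.differentiableAt.differentiableWithinAt
  · intro t ht
    obtain ⟨d, hd, hle⟩ := hder t ht
    rwa [hd.deriv]

end IsFlow
end AnisoFlow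

/-! ### Conclusion. -/

theorem mainTheorem4 (p : ℝ → ℝ) (hp : AnisoFlow.IsAnisotropy p)
    (hsymm : Function.Periodic p π)
    (X₀ : ℝ → ℂ) (hX₀ : AnisoFlow.IsConvexByAngle X₀)
    (T : EReal) (hT : 0 < T)
    (X : ℝ → ℝ → ℂ) (hX : AnisoFlow.IsFlow p X₀ T X) :
    AntitoneOn (fun t => AnisoFlow.anisoDeficit p (X t)) (AnisoFlow.timeInterval T) ∧
    (∀ t ∈ AnisoFlow.timeInterval T,
      0 ≤ AnisoFlow.anisoDeficit p (X t) ∧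
      AnisoFlow.anisoDeficit p (X t) ≤ AnisoFlow.anisoDeficit p X₀ *
        Real.exp (-(8 * AnisoFlow.wulffArea p ^ 2 * t / AnisoFlow.anisoLength p X₀ ^ 2))) ∧
    (T = ⊤ → Tendsto (fun t => AnisoFlow.anisoDeficit p (X t)) atTop (𝓝 0)) := by
  have hW := hp.wulffArea_pos
  have hL := hX₀.anisoLength_pos hp
  have hnn := fun t (ht : t ∈ AnisoFlow.timeInterval T) =>
    hX.anisoDeficit_nonneg hp hX₀ hT hsymm ht
  have hbound : ∀ t ∈ AnisoFlow.timeInterval T, AnisoFlow.anisoDeficit p (X t) ≤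
      AnisoFlow.anisoDeficit p X₀ *
        Real.exp (-(8 * AnisoFlow.wulffArea p ^ 2 * t / AnisoFlow.anisoLength p X₀ ^ 2)) := by
    intro t ht
    have h := hX.antitoneOn_exp_mul_anisoDeficit hp hX₀ hT hsymm le_rfl
      (AnisoFlow.zero_mem_timeInterval hT) ht ht.1
    simp only [mul_zero, Real.exp_zero, one_mul, hX.initial] at h
    rw [Real.exp_neg, ← div_eq_mul_inv, le_div_iff₀ (Real.exp_pos _), mul_comm]
    rwa [mul_div_right_comm]
  refine ⟨?_, fun t ht => ⟨hnn t ht, hbound t ht⟩, ?_⟩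
  -- At rate `0` the exponential weight is `1`, leaving the deficit itself.
  · have h := hX.antitoneOn_exp_mul_anisoDeficit hp hX₀ hT hsymm (c := 0) (by positivity)
    simpa using h
  · intro hTtop
    have hmem : ∀ t : ℝ, 0 ≤ t → t ∈ AnisoFlow.timeInterval T := fun t ht =>
      ⟨ht, hTtop ▸ EReal.coe_lt_top t⟩
    have hlim : Tendsto (fun t : ℝ => AnisoFlow.anisoDeficit p X₀ *
        Real.exp (-(8 * AnisoFlow.wulffArea p ^ 2 * t / AnisoFlow.anisoLength p X₀ ^ 2)))
        atTop (𝓝 0) := by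
      have h1 : Tendsto (fun t : ℝ => 8 * AnisoFlow.wulffArea p ^ 2 * t /
          AnisoFlow.anisoLength p X₀ ^ 2) atTop atTop :=
        (tendsto_id.const_mul_atTop (by positivity)).atTop_div_const (by positivity)
      simpa using (Real.tendsto_exp_neg_atTop_nhds_zero.comp h1).const_mul
        (AnisoFlow.anisoDeficit p X₀)
    refine tendsto_of_tendsto_of_tendsto_of_le_of_le' tendsto_const_nhds hlim ?_ ?_
    · filter_upwards [eventually_ge_atTop 0] with t ht using hnn t (hmem t ht)
    · filter_upwards [eventually_ge_atTop 0] with t ht using hbound t (hmem t ht)
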